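/- Let $(\mathbb K,\partial)$ be a differential field with field of constants $\Bbbk$, and let $U=\mathbb K[Y;\partial]=\bigoplus_{i\ge0}Y^i\mathbb K$ be the Ore extension with $xY=Yx+\partial(x)$, with inclusion $\tau:\mathbb K\to U$. Let $U^*$ be the space of right $\mathbb K$-linear maps $U\to\mathbb K$, an algebra under the convolution $(f*g)(Y^n)=\sum_k\binom nk f(Y^k)g(Y^{n-k})$. Let $\mathcal H(\mathbb K)=\mathbb K^{\mathbb N}$ with the Hurwitz product $(\alpha\beta)(n)=\sum_k\binom nk\alpha(k)\beta(n-k)$, shift $N$, source $s(x)=(x,0,0,\dots)$ and target $t(x)=(\partial^n x)_n$; it is a two-sided $\mathbb K$-vector space, on the left via $s$ and on the right via $t$. Let $\mathsf{Dlin}(\mathbb K)\subseteq\mathcal H(\mathbb K)$ be the set of $\alpha$ with $\sum_{i=0}^d t(c_i)N^i(\alpha)=0$ for some $d\ge0$ and $c_0,\dots,c_d\in\mathbb K$ with $c_d\ne0$. All corings and Hopf algebroids below have base $\mathbb K$, and $\Bbbk$ acts centrally on all bimodules. A SAFT-dual coring $U^\bullet$ is a $\mathbb K$-coring with a $\Bbbk$-linear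 map $\xi$ to $U^*$ satisfying $$\xi(z)(uv)=\sum\xi(z_{(1)})\bigl(\tau(\xi(z_{(2)})(u))\,v\bigr),\qquad \xi(z)(1)=\varepsilon(z),\qquad \xi(x\cdot z\cdot y)(u)=x\,\xi(z)(\tau(y)u),\qquad(*)$$ such that for every $\mathbb K$-coring $C$ with a $\Bbbk$-linear map $f:C\to U^*$ satisfying $(*)$ there is a unique coring homomorphism $\hat f:C\to U^\bullet$ with $\xi\circ\hat f=f$. The finite dual is $U^\circ=\bigl(\bigoplus_{M}M^*\otimes_{T_M}M\bigr)/\langle\psi\otimes f(m)-\psi f\otimes m\rangle$, where $M,N$ run over the finite-dimensional differential $\mathbb K$-vector spaces, $f$ over the differential maps $M\to N$, $\psi$ over $N^*$, $m$ over $M$, and $T_M$ is the ring of differential endomorphisms of $M$. Then: (1) $\mathsf{Dlin}(\mathbb K)$ is a commutative Hopf algebroid with the Hurwitz product, source $s$, target $t$, counit $\varepsilon(\alpha)=\alpha(0)$, antipode $\mathscr S(\alpha)(n)=\sum_{k=0}^n\binom nk(-1)^{n-k}\partial^k(\alpha(n-k))$ and comultiplication $\Delta(\alpha)=\sum_{i<d}N^i(\alpha)\otimes_{\mathbb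 K}(y_i^*(y_n))_{n\ge0}$; here $N^d(\alpha)=\sum_{i<d}t(c_i)N^i(\alpha)$, $P=Y^d-\sum_{i<d}Y^ic_i$, $y_n$ is the class of $Y^n$ in $U/PU$, and $(y_i^*)_{i<d}$ is the basis dual to $(y_i)_{i<d}$. (2) The map $\xi:\mathsf{Dlin}(\mathbb K)\to U^*$, $\xi(\alpha)(Y^n)=\alpha(n)$, is an injective morphism of algebras, and $\mathsf{Dlin}(\mathbb K)$ with $\xi$ is a SAFT-dual coring $U^\bullet$. (3) $U^\circ$ is a commutative Hopf algebroid with the following structure. The source is $x\mapsto\overline{x\otimes1}$ and the target is $x\mapsto\overline{1\otimes x}$, both in the class of $M=(\mathbb K,\partial)$. The product is $\overline{\varphi\otimes p}\cdot\overline{\psi\otimes q}=\overline{(\psi\diamond\varphi)\otimes(q\otimes p)}$ with $(\psi\diamond\varphi)(q\otimes p)=\psi(q)\varphi(p)$. The counit is $\overline{\varphi\otimes m}\mapsto\varphi(m)$. The comultiplication is $\overline{\varphi\otimes m}\mapsto\sum_i\overline{\varphi\otimes e_i}\otimes_{\mathbb K}\overline{e_i^*\otimes m}$, for any basis $(e_i)$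 of $M$. The antipode is $\overline{\varphi\otimes m}\mapsto\overline{\mathrm{ev}_m\otimes\varphi}$. The map $\overline{\varphi\otimes m}\mapsto(\varphi(\partial_M^n(m)))_{n\ge0}$ is an isomorphism of Hopf algebroids $U^\circ\cong\mathsf{Dlin}(\mathbb K)$. (4) Every SAFT-dual coring $(U^\bullet,\xi^\bullet)$ has exactly one structure of commutative Hopf algebroid, extending its coring structure, for which $\xi^\bullet:U^\bullet\to U^*$ is a morphism of algebras. With it there is exactly one isomorphism of Hopf algebroids $e:\mathsf{Dlin}(\mathbb K)\to U^\bullet$ with $\xi^\bullet\circ e=\xi$. Hence $U^\circ\cong\mathsf{Dlin}(\mathbb K)\cong U^\bullet$. -/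

import Mathlib

universe u v w

open scoped TensorProduct Differential RightActions

noncomputable section

namespace DRec

/-! ## Two-sided vector spaces over a field and their tensor product

A `K`-bimodule `M` is an abelian group with a left action `x • m` and a right action `m <• x`
of `K` which commute. The two actions need not coincide. -/

section Bimodules

variable (K : Type u) [Field K]

/-- `M` as a `K`-vector space through its right action. -/
@[nolint unusedArguments]
def RightMod (_K : Type u) (M : Type v) : Type v := M

instance (M : Type*) [AddCommGroup M] : AddCommGroup (RightMod K M) :=
  inferInstanceAs (AddCommGroup M)

/-- The identity map from `M` to `RightMod K M`. -/
def RightMod.of (M : Type*) [AddCommGroup M] : M ≃+ RightMod K M := AddEquiv.refl M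

instance (M : Type*) [AddCommGroup M] [Module Kᵐᵒᵖ M] : Module K (RightMod K M) :=
  Module.compHom M (RingEquiv.toOpposite K).toRingHom

theorem RightMod.smul_of {M : Type*} [AddCommGroup M] [Module Kᵐᵒᵖ M] (x : K) (m : M) :
    x • RightMod.of K M m = RightMod.of K M (m <• x) := rfl

/-- The tensor product `M ⊗_K N` of two bimodules, balanced by `(m <• x) ⊗ n = m ⊗ (x • n)`. -/
def BiTensor (M : Type v) (N : Type w) [AddCommGroup M] [Module Kᵐᵒᵖ M] [AddCommGroup N]
    [Module K N] : Type (max v w) :=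
  RightMod K M ⊗[K] N

variable {K}

/-- Homomorphisms of `K`-bimodules. -/
structure BimodHom (K : Type u) [Field K] (M N : Type*)
    [AddCommGroup M] [Module K M] [Module Kᵐᵒᵖ M]
    [AddCommGroup N] [Module K N] [Module Kᵐᵒᵖ N] extends M →ₗ[K] N where
  map_rsmul : ∀ (x : K) (m : M), toFun (m <• x) = toFun m <• x

instance (M N : Type*) [AddCommGroup M] [Module K M] [Module Kᵐᵒᵖ M]
    [AddCommGroup N] [Module K N] [Module Kᵐᵒᵖ N] : CoeFun (BimodHom K M N) (fun _ => M → N) :=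
  ⟨fun f => f.toFun⟩

/-- A bimodule homomorphism as a linear map for the right actions. -/
def BimodHom.right {M N : Type*} [AddCommGroup M] [Module K M] [Module Kᵐᵒᵖ M]
    [AddCommGroup N] [Module K N] [Module Kᵐᵒᵖ N] (f : BimodHom K M N) :
    RightMod K M →ₗ[K] RightMod K N where
  toFun m := RightMod.of K N (f ((RightMod.of K M).symm m))
  map_add' := f.map_add'
  map_smul' := f.map_rsmul

/-- The identity of a bimodule. -/
def BimodHom.id (K : Type u) [Field K] (M : Type*) [AddCommGroup M] [Module K M]
    [Module Kᵐᵒᵖ M] : BimodHom K M M where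
  toLinearMap := LinearMap.id
  map_rsmul _ _ := rfl

namespace BiTensor

section
variable {M N : Type*} [AddCommGroup M] [Module Kᵐᵒᵖ M] [AddCommGroup N] [Module K N]

instance : AddCommGroup (BiTensor K M N) := inferInstanceAs (AddCommGroup (RightMod K M ⊗[K] N))

variable (K) in
/-- The pure tensor `m ⊗ n`. -/
def tmul (m : M) (n : N) : BiTensor K M N := TensorProduct.tmul K (RightMod.of K M m) n

theorem tmul_balanced (m : M) (x : K) (n : N) : tmul K (m <• x) n = tmul K m (x • n) :=
  TensorProduct.smul_tmul (R := K) x (RightMod.of K M m) n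

theorem add_tmul (m m' : M) (n : N) : tmul K (m + m') n = tmul K m n + tmul K m' n :=
  TensorProduct.add_tmul (R := K) (RightMod.of K M m) (RightMod.of K M m') n

theorem tmul_add (m : M) (n n' : N) : tmul K m (n + n') = tmul K m n + tmul K m n' :=
  TensorProduct.tmul_add (R := K) (RightMod.of K M m) n n'

variable (K M N) in
/-- The pure tensor as a biadditive map. -/
def tmulHom : M →+ N →+ BiTensor K M N :=
  AddMonoidHom.mk' (fun m => AddMonoidHom.mk' (tmul K m) (tmul_add m))
    (fun m m' => by ext n; exact add_tmul m m' n)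

/-- The additive map out of `M ⊗_K N` given by a balanced biadditive map. -/
def lift {A : Type*} [AddCommGroup A] (f : M →+ N →+ A)
    (hf : ∀ (m : M) (x : K) (n : N), f (m <• x) n = f m (x • n)) : BiTensor K M N →+ A :=
  TensorProduct.liftAddHom (R := K) (M := RightMod K M)
    (f.comp (RightMod.of K M).symm.toAddMonoidHom) (fun x m n => hf ((RightMod.of K M).symm m) x n)

theorem lift_tmul {A : Type*} [AddCommGroup A] (f : M →+ N →+ A)
    (hf : ∀ (m : M) (x : K) (n : N), f (m <• x) n = f m (x • n)) (m : M) (n : N) :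
    lift f hf (tmul K m n) = f m n := rfl

theorem induction_on {p : BiTensor K M N → Prop} (z : BiTensor K M N) (zero : p 0)
    (tmul : ∀ m n, p (tmul K m n)) (add : ∀ a b, p a → p b → p (a + b)) : p z :=
  TensorProduct.induction_on z zero tmul add

end

section
variable {M N : Type*} [AddCommGroup M] [Module K M] [Module Kᵐᵒᵖ M] [SMulCommClass K Kᵐᵒᵖ M]
  [AddCommGroup N] [Module K N] [Module Kᵐᵒᵖ N] [SMulCommClass K Kᵐᵒᵖ N]

/-- `m ⊗ n ↦ (x • m) ⊗ n`. -/
def lact (x : K) : BiTensor K M N →+ BiTensor K M N :=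
  lift ((tmulHom K M N).comp (DistribSMul.toAddMonoidHom M x)) (fun m y n => by
    change tmul K (x • (m <• y)) n = tmul K (x • m) (y • n)
    rw [smul_comm x (MulOpposite.op y) m, tmul_balanced])

/-- `m ⊗ n ↦ m ⊗ (n <• y)`. -/
def ract (y : Kᵐᵒᵖ) : BiTensor K M N →+ BiTensor K M N :=
  lift ((AddMonoidHom.compl₂ (tmulHom K M N)) (DistribSMul.toAddMonoidHom N y)) (fun m x n => by
    change tmul K (m <• x) (y • n) = tmul K m (y • (x • n))
    rw [tmul_balanced, smul_comm x y n])

/-- `x • (m ⊗ n) = (x • m) ⊗ n`. -/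
instance : Module K (BiTensor K M N) where
  smul x z := lact x z
  one_smul z := by
    change lact 1 z = z
    induction z using induction_on with
    | zero => exact map_zero _
    | tmul m n => exact congrArg (tmul K · n) (one_smul K m)
    | add a b ha hb => rw [map_add, ha, hb]
  mul_smul x y z := by
    change lact (x * y) z = lact x (lact y z)
    induction z using induction_on with
    | zero => simp only [map_zero]
    | tmul m n => exact congrArg (tmul K · n) (mul_smul x y m)
    | add a b ha hb => simp only [map_add, ha, hb]
  smul_zero x := map_zero (lact x)
  smul_add x := map_add (lact x)
  add_smul x y z := by
    change lact (x + y) z = lact x z + lact y z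
    induction z using induction_on with
    | zero => simp only [map_zero, add_zero]
    | tmul m n => exact (congrArg (tmul K · n) (add_smul x y m)).trans (add_tmul _ _ n)
    | add a b ha hb => simp only [map_add, ha, hb]; abel
  zero_smul z := by
    change lact 0 z = 0
    induction z using induction_on with
    | zero => exact map_zero _
    | tmul m n =>
      exact (congrArg (tmul K · n) (zero_smul K m)).trans
        (TensorProduct.zero_tmul (RightMod K M) n)
    | add a b ha hb => rw [map_add, ha, hb, add_zero]

/-- `(m ⊗ n) <• y = m ⊗ (n <• y)`. -/
instance : Module Kᵐᵒᵖ (BiTensor K M N) where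
  smul y z := ract y z
  one_smul z := by
    change ract 1 z = z
    induction z using induction_on with
    | zero => exact map_zero _
    | tmul m n => exact congrArg (tmul K m) (one_smul Kᵐᵒᵖ n)
    | add a b ha hb => rw [map_add, ha, hb]
  mul_smul x y z := by
    change ract (x * y) z = ract x (ract y z)
    induction z using induction_on with
    | zero => simp only [map_zero]
    | tmul m n => exact congrArg (tmul K m) (mul_smul x y n)
    | add a b ha hb => simp only [map_add, ha, hb]
  smul_zero x := map_zero (ract x)
  smul_add x := map_add (ract x)
  add_smul x y z := by
    change ract (x + y) z = ract x z + ract y z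
    induction z using induction_on with
    | zero => simp only [map_zero, add_zero]
    | tmul m n => exact (congrArg (tmul K m) (add_smul x y n)).trans (tmul_add m _ _)
    | add a b ha hb => simp only [map_add, ha, hb]; abel
  zero_smul z := by
    change ract 0 z = 0
    induction z using induction_on with
    | zero => exact map_zero _
    | tmul m n =>
      exact (congrArg (tmul K m) (zero_smul Kᵐᵒᵖ n)).trans
        (TensorProduct.tmul_zero N (RightMod.of K M m))
    | add a b ha hb => rw [map_add, ha, hb, add_zero]

instance : SMulCommClass K Kᵐᵒᵖ (BiTensor K M N) where
  smul_comm x y z := by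
    induction z using induction_on with
    | zero => simp only [smul_zero]
    | tmul m n => rfl
    | add a b ha hb => simp only [smul_add, ha, hb]

end

/-- The map `f ⊗ g`. -/
def map {M N M' N' : Type*}
    [AddCommGroup M] [Module K M] [Module Kᵐᵒᵖ M] [AddCommGroup N] [Module K N] [Module Kᵐᵒᵖ N]
    [AddCommGroup M'] [Module K M'] [Module Kᵐᵒᵖ M']
    [AddCommGroup N'] [Module K N'] [Module Kᵐᵒᵖ N']
    (f : BimodHom K M M') (g : BimodHom K N N') : BiTensor K M N →+ BiTensor K M' N' :=
  (TensorProduct.map f.right g.toLinearMap).toAddMonoidHom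

/-- The associativity `(M ⊗ N) ⊗ P → M ⊗ (N ⊗ P)`, `(m ⊗ n) ⊗ p ↦ m ⊗ (n ⊗ p)`. -/
def assoc (M N P : Type*)
    [AddCommGroup M] [Module K M] [Module Kᵐᵒᵖ M] [SMulCommClass K Kᵐᵒᵖ M]
    [AddCommGroup N] [Module K N] [Module Kᵐᵒᵖ N] [SMulCommClass K Kᵐᵒᵖ N]
    [AddCommGroup P] [Module K P] [Module Kᵐᵒᵖ P] [SMulCommClass K Kᵐᵒᵖ P] :
    BiTensor K (BiTensor K M N) P →+ BiTensor K M (BiTensor K N P) :=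
  lift
    (lift
      (AddMonoidHom.mk'
        (fun m => (AddMonoidHom.compHom (tmulHom K M (BiTensor K N P) m)).comp (tmulHom K N P))
        (fun m m' => by ext n p; exact add_tmul m m' _))
      (fun m x n => by ext p; exact tmul_balanced m x (tmul K n p)))
    (fun z x p => by
      induction z using induction_on with
      | zero => simp
      | tmul m n => exact congrArg (tmul K m) (tmul_balanced n x p)
      | add a b ha hb => rw [smul_add, map_add, map_add, AddMonoidHom.add_apply, ha, hb]; rfl)

theorem assoc_tmul {M N P : Type*}
    [AddCommGroup M] [Module K M] [Module Kᵐᵒᵖ M] [SMulCommClass K Kᵐᵒᵖ M]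
    [AddCommGroup N] [Module K N] [Module Kᵐᵒᵖ N] [SMulCommClass K Kᵐᵒᵖ N]
    [AddCommGroup P] [Module K P] [Module Kᵐᵒᵖ P] [SMulCommClass K Kᵐᵒᵖ P]
    (m : M) (n : N) (p : P) :
    assoc M N P (tmul K (tmul K m n) p) = tmul K m (tmul K n p) := rfl

/-- The action `K ⊗ N → N`, `x ⊗ n ↦ x • n`. -/
def leftUnitor (N : Type*) [AddCommGroup N] [Module K N] : BiTensor K K N →+ N :=
  lift (AddMonoidHom.mk' (fun x => AddMonoidHom.mk' (fun n => x • n) (smul_add x))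
      (fun x y => by ext n; exact add_smul x y n))
    (fun m x n => by
      change (m <• x) • n = m • (x • n)
      rw [op_smul_eq_mul, mul_smul])

/-- The action `M ⊗ K → M`, `m ⊗ x ↦ m <• x`. -/
def rightUnitor (M : Type*) [AddCommGroup M] [Module Kᵐᵒᵖ M] : BiTensor K M K →+ M :=
  lift (AddMonoidHom.mk' (fun m => AddMonoidHom.mk' (fun x : K => m <• x)
        (fun x y => by rw [MulOpposite.op_add, add_smul]))
      (fun m m' => by ext x; exact smul_add (MulOpposite.op x) m m'))
    (fun m x y => by
      change (m <• x) <• y = m <• (x • y)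
      rw [smul_eq_mul, MulOpposite.op_mul, mul_smul])

end BiTensor

end Bimodules

/-! ## Corings and commutative Hopf algebroids over a differential field -/

section Corings

/-- A `K`-coring, for a differential field `K`, viewed as an algebra over its field of constants:
a comonoid in the monoidal category of `K`-bimodules on which the constants act centrally. -/
structure Coring (K : Type u) [Field K] [Differential K] (C : Type v) [AddCommGroup C]
    [Module K C] [Module Kᵐᵒᵖ C] [SMulCommClass K Kᵐᵒᵖ C] where
  central : ∀ x : K, x′ = 0 → ∀ c : C, x • c = c <• x
  comul : BimodHom K C (BiTensor K C C)
  counit : BimodHom K C K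
  coassoc : ∀ c : C, BiTensor.assoc C C C (BiTensor.map comul (BimodHom.id K C) (comul c)) =
    BiTensor.map (BimodHom.id K C) comul (comul c)
  counit_left : ∀ c : C,
    BiTensor.leftUnitor C (BiTensor.map counit (BimodHom.id K C) (comul c)) = c
  counit_right : ∀ c : C,
    BiTensor.rightUnitor C (BiTensor.map (BimodHom.id K C) counit (comul c)) = c

variable {K : Type u} [Field K] [Differential K]
  {C : Type v} [AddCommGroup C] [Module K C] [Module Kᵐᵒᵖ C] [SMulCommClass K Kᵐᵒᵖ C]
  {D : Type w} [AddCommGroup D] [Module K D] [Module Kᵐᵒᵖ D] [SMulCommClass K Kᵐᵒᵖ D]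

/-- Homomorphisms of `K`-corings. -/
structure IsCoringHom (Γ : Coring K C) (Λ : Coring K D) (f : BimodHom K C D) : Prop where
  comul : ∀ c, Λ.comul (f c) = BiTensor.map f f (Γ.comul c)
  counit : ∀ c, Λ.counit (f c) = Γ.counit c

/-- A commutative Hopf algebroid over the base `K` (an algebra over its field of constants) with
underlying bimodule `C`. The source is `x ↦ x • 1` and the target is `x ↦ 1 <• x`; the tensor
product `C ⊗_K C` is balanced over the target on the left and the source on the right. -/
structure HopfAlgebroid (K : Type u) [Field K] [Differential K] (C : Type v) [AddCommGroup C]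
    [Module K C] [Module Kᵐᵒᵖ C] [SMulCommClass K Kᵐᵒᵖ C] extends Coring K C where
  mul : C → C → C
  one : C
  antipode : C → C
  add_mul : ∀ a b c, mul (a + b) c = mul a c + mul b c
  mul_comm : ∀ a b, mul a b = mul b a
  mul_assoc : ∀ a b c, mul (mul a b) c = mul a (mul b c)
  one_mul : ∀ a, mul one a = a
  smul_mul : ∀ (x : K) a b, mul (x • a) b = x • mul a b
  rsmul_mul : ∀ (x : K) a b, mul (a <• x) b = mul a b <• x
  counit_one : counit one = 1
  counit_mul : ∀ a b, counit (mul a b) = counit a * counit b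
  comul_one : comul one = BiTensor.tmul K one one
  comul_mul : ∀ (a b : C) (m n : ℕ) (a₁ a₂ : Fin m → C) (b₁ b₂ : Fin n → C),
    comul a = ∑ i, BiTensor.tmul K (a₁ i) (a₂ i) →
    comul b = ∑ j, BiTensor.tmul K (b₁ j) (b₂ j) →
    comul (mul a b) = ∑ i, ∑ j, BiTensor.tmul K (mul (a₁ i) (b₁ j)) (mul (a₂ i) (b₂ j))
  antipode_add : ∀ a b, antipode (a + b) = antipode a + antipode b
  antipode_mul : ∀ a b, antipode (mul a b) = mul (antipode a) (antipode b)
  antipode_source : ∀ x : K, antipode (x • one) = one <• x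
  antipode_target : ∀ x : K, antipode (one <• x) = x • one
  antipode_antipode : ∀ a, antipode (antipode a) = a
  antipode_left : ∀ (a : C) (m : ℕ) (a₁ a₂ : Fin m → C),
    comul a = ∑ i, BiTensor.tmul K (a₁ i) (a₂ i) →
    ∑ i, mul (antipode (a₁ i)) (a₂ i) = one <• counit a
  antipode_right : ∀ (a : C) (m : ℕ) (a₁ a₂ : Fin m → C),
    comul a = ∑ i, BiTensor.tmul K (a₁ i) (a₂ i) →
    ∑ i, mul (a₁ i) (antipode (a₂ i)) = counit a • one

/-- Isomorphisms of commutative Hopf algebroids which are the identity on the base `K`. -/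
structure IsHopfIso (H : HopfAlgebroid K C) (L : HopfAlgebroid K D) (f : BimodHom K C D) : Prop
    extends IsCoringHom H.toCoring L.toCoring f where
  one : f H.one = L.one
  mul : ∀ a b, f (H.mul a b) = L.mul (f a) (f b)
  antipode : ∀ a, f (H.antipode a) = L.antipode (f a)
  bijective : Function.Bijective f.toFun

end Corings

/-! ## Hurwitz series and differentially recursive sequences -/

section Hurwitz

/-- The ring of Hurwitz series over `K`: sequences with the product
`(α * β) n = ∑ k ≤ n, (n choose k) α k β (n - k)`. -/
@[ext]
structure Hurwitz (K : Type u) where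
  /-- The `n`-th term of the sequence. -/
  coeff : ℕ → K

variable {K : Type u} [Field K]

namespace Hurwitz

/-- Sequences with their termwise addition. -/
def equivFun : Hurwitz K ≃ (ℕ → K) := ⟨coeff, mk, fun _ => rfl, fun _ => rfl⟩

instance : AddCommGroup (Hurwitz K) := equivFun.addCommGroup

/-- The left action is termwise. -/
instance : Module K (Hurwitz K) := equivFun.module K

instance : Mul (Hurwitz K) :=
  ⟨fun α β => ⟨fun n =>
    ∑ k ∈ Finset.range (n + 1), (n.choose k : K) * (α.coeff k * β.coeff (n - k))⟩⟩

/-- The source map `s x = (x, 0, 0, …)`. -/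
def source (x : K) : Hurwitz K := ⟨fun n => if n = 0 then x else 0⟩

instance : One (Hurwitz K) := ⟨source 1⟩

/-- The shift operator. -/
def shift : Hurwitz K →ₗ[K] Hurwitz K where
  toFun α := ⟨fun n => α.coeff (n + 1)⟩
  map_add' _ _ := rfl
  map_smul' _ _ := rfl

theorem shift_coeff (α : Hurwitz K) (n : ℕ) : (shift α).coeff n = α.coeff (n + 1) := rfl

theorem zero_coeff (n : ℕ) : (0 : Hurwitz K).coeff n = 0 := rfl

theorem add_coeff (α β : Hurwitz K) (n : ℕ) : (α + β).coeff n = α.coeff n + β.coeff n := rfl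

theorem smul_coeff (x : K) (α : Hurwitz K) (n : ℕ) : (x • α).coeff n = x * α.coeff n := rfl

theorem mul_coeff (α β : Hurwitz K) (n : ℕ) : (α * β).coeff n =
    ∑ k ∈ Finset.range (n + 1), (n.choose k : K) * (α.coeff k * β.coeff (n - k)) := rfl

theorem mul_coeff_zero (α β : Hurwitz K) : (α * β).coeff 0 = α.coeff 0 * β.coeff 0 := by
  simp [mul_coeff]

theorem shift_mul (α β : Hurwitz K) : shift (α * β) = shift α * β + α * shift β := by
  ext n
  have h := Finset.sum_choose_succ_mul (fun i j => α.coeff i * β.coeff j) n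
  rw [shift_coeff, mul_coeff, h, add_coeff, mul_coeff, mul_coeff, add_comm]
  congr 1
  refine Finset.sum_congr rfl fun k hk => ?_
  rw [shift_coeff, Nat.succ_sub (Nat.lt_succ_iff.mp (Finset.mem_range.mp hk))]

protected theorem add_mul (α β γ : Hurwitz K) : (α + β) * γ = α * γ + β * γ := by
  ext n
  simp only [mul_coeff, add_coeff, ← Finset.sum_add_distrib]
  exact Finset.sum_congr rfl fun k _ => by ring

protected theorem mul_comm (α β : Hurwitz K) : α * β = β * α := by
  have : ∀ n, ∀ α β : Hurwitz K, (α * β).coeff n = (β * α).coeff n := by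
    intro n
    induction n with
    | zero => intro α β; rw [mul_coeff_zero, mul_coeff_zero, mul_comm]
    | succ n ih =>
      intro α β
      rw [← shift_coeff, ← shift_coeff, shift_mul, shift_mul, add_coeff, add_coeff, ih, ih α,
        add_comm]
  exact Hurwitz.ext (funext fun n => this n α β)

protected theorem mul_add (α β γ : Hurwitz K) : α * (β + γ) = α * β + α * γ := by
  rw [Hurwitz.mul_comm, Hurwitz.add_mul, Hurwitz.mul_comm β, Hurwitz.mul_comm γ]

protected theorem mul_assoc (α β γ : Hurwitz K) : α * β * γ = α * (β * γ) := by
  have : ∀ n, ∀ α β γ : Hurwitz K, (α * β * γ).coeff n = (α * (β * γ)).coeff n := by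
    intro n
    induction n with
    | zero => intro α β γ; simp only [mul_coeff_zero, mul_assoc]
    | succ n ih =>
      intro α β γ
      rw [← shift_coeff, ← shift_coeff]
      simp only [shift_mul, Hurwitz.add_mul, Hurwitz.mul_add, add_coeff, ih]
      ring
  exact Hurwitz.ext (funext fun n => this n α β γ)

theorem source_mul (x : K) (α : Hurwitz K) : source x * α = x • α := by
  ext n
  rw [mul_coeff, Finset.sum_eq_single 0]
  · simp [source, smul_coeff]
  · intro k _ hk
    simp [source, hk]
  · simp

instance : CommRing (Hurwitz K) :=
  { (inferInstance : AddCommGroup (Hurwitz K)) with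
    mul := (· * ·)
    one := 1
    left_distrib := Hurwitz.mul_add
    right_distrib := Hurwitz.add_mul
    zero_mul := fun α => by simpa using Hurwitz.add_mul 0 0 α
    mul_zero := fun α => by simpa using Hurwitz.mul_add α 0 0
    mul_assoc := Hurwitz.mul_assoc
    one_mul := fun α => (source_mul 1 α).trans (one_smul K α)
    mul_one := fun α => (Hurwitz.mul_comm α 1).trans ((source_mul 1 α).trans (one_smul K α))
    mul_comm := Hurwitz.mul_comm }

theorem smul_eq (x : K) (α : Hurwitz K) : x • α = source x * α := (source_mul x α).symm

variable [Differential K]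

/-- The sequence `(x, ∂ x, ∂² x, …)`. -/
def taylor (x : K) : Hurwitz K := ⟨fun n => (Differential.deriv (R := K))^[n] x⟩

theorem taylor_coeff (x : K) (n : ℕ) :
    (taylor x).coeff n = (Differential.deriv (R := K))^[n] x := rfl

theorem shift_taylor (x : K) : shift (taylor x) = taylor x′ := rfl

theorem taylor_zero : taylor (0 : K) = 0 := by
  ext n
  exact Function.iterate_fixed (map_zero (Differential.deriv (R := K))) n

theorem taylor_add (x y : K) : taylor (x + y) = taylor x + taylor y := by
  ext n
  exact iterate_map_add (Differential.deriv (R := K)) n x y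

/-- The target map (Hurwitz mapping) `t x = (x, ∂ x, ∂² x, …)`. -/
def target : K →+* Hurwitz K where
  toFun := taylor
  map_zero' := taylor_zero
  map_add' := taylor_add
  map_one' := by
    ext n
    cases n with
    | zero => rfl
    | succ n =>
      rw [← shift_coeff, shift_taylor, Derivation.map_one_eq_zero, taylor_zero]
      rfl
  map_mul' x y := by
    have : ∀ n, ∀ x y : K, (taylor (x * y)).coeff n = (taylor x * taylor y).coeff n := by
      intro n
      induction n with
      | zero => intro x y; rw [mul_coeff_zero]; rfl
      | succ n ih =>
        intro x y
        have h1 : (x * y)′ = x′ * y + x * y′ := by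
          rw [Derivation.leibniz]; simp only [smul_eq_mul]; ring
        rw [← shift_coeff, ← shift_coeff, shift_taylor, h1, taylor_add, shift_mul, add_coeff,
          add_coeff, ih, ih, shift_taylor, shift_taylor]
    exact Hurwitz.ext (funext fun n => this n x y)

theorem target_coeff (x : K) (n : ℕ) :
    (target x).coeff n = (Differential.deriv (R := K))^[n] x := rfl

theorem shift_target (x : K) : shift (target x) = target x′ := rfl

/-- The right action of `K` is multiplication by the target: `α <• y = α * t y`. -/
instance : Module Kᵐᵒᵖ (Hurwitz K) :=
  Module.compHom (Hurwitz K) (target.comp (RingEquiv.toOpposite K).symm.toRingHom)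

theorem rsmul_eq (α : Hurwitz K) (y : K) : α <• y = α * target y :=
  Hurwitz.mul_comm (target y) α

instance : SMulCommClass K Kᵐᵒᵖ (Hurwitz K) where
  smul_comm x y α := by
    change x • (α <• y.unop) = (x • α) <• y.unop
    rw [rsmul_eq, rsmul_eq, smul_eq, smul_eq, mul_assoc]

/-- `α` is differentially recursive if `∑_{i ≤ d} t(c_i) N^i(α) = 0` for some `d` and some
`c_0, …, c_d` in `K` with `c_d ≠ 0`, where `N` is the shift. -/
def IsDiffRecursive (α : Hurwitz K) : Prop :=
  ∃ (d : ℕ) (c : ℕ → K), c d ≠ 0 ∧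
    ∑ i ∈ Finset.range (d + 1), target (c i) * shift^[i] α = 0

theorem shift_rsmul (α : Hurwitz K) (y : K) : shift (α <• y) = shift α <• y + α <• y′ := by
  rw [rsmul_eq, shift_mul, shift_target, rsmul_eq, rsmul_eq]

/-- Differential recursiveness through finite-dimensional shift-stable spaces. -/
theorem isDiffRecursive_iff (α : Hurwitz K) : IsDiffRecursive α ↔
    ∃ W : Submodule Kᵐᵒᵖ (Hurwitz K), Module.Finite Kᵐᵒᵖ W ∧ (∀ β ∈ W, shift β ∈ W) ∧ α ∈ W := by
  constructor
  · rintro ⟨d, c, hc, h⟩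
    let S : Set (Hurwitz K) := (fun i => shift^[i] α) '' (Finset.range d : Set ℕ)
    let W := Submodule.span Kᵐᵒᵖ S
    have hS : ∀ i < d, shift^[i] α ∈ W := fun i hi =>
      Submodule.subset_span ⟨i, by simpa using hi, rfl⟩
    have hd : shift^[d] α ∈ W := by
      have h2 : ∑ i ∈ Finset.range d, shift^[i] α <• c i + shift^[d] α <• c d = 0 := by
        rw [← h, Finset.sum_range_succ]
        simp only [rsmul_eq, mul_comm]
      have h3 : shift^[d] α <• c d ∈ W := by
        rw [eq_neg_of_add_eq_zero_right h2]
        exact W.neg_mem (W.sum_mem fun i hi => W.smul_mem _ (hS i (Finset.mem_range.mp hi)))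
      have h4 := W.smul_mem (MulOpposite.op (c d)⁻¹) h3
      rwa [smul_smul, ← MulOpposite.op_mul, mul_inv_cancel₀ hc, MulOpposite.op_one, one_smul]
        at h4
    have hstab : ∀ β ∈ W, shift β ∈ W := by
      intro β hβ
      induction hβ using Submodule.span_induction with
      | mem x hx =>
        obtain ⟨i, hi, rfl⟩ := hx
        have he : shift (shift^[i] α) = shift^[i + 1] α :=
          (Function.iterate_succ_apply' shift i α).symm
        change shift (shift^[i] α) ∈ W
        rw [he]
        have hi' : i < d := by simpa using hi
        rcases Nat.lt_or_ge (i + 1) d with h5 | h5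
        · exact hS _ h5
        · rwa [show i + 1 = d by omega]
      | zero => rw [map_zero]; exact W.zero_mem
      | add x y _ _ hx hy => rw [map_add]; exact W.add_mem hx hy
      | smul a x hx ih =>
        change shift (x <• a.unop) ∈ W
        rw [shift_rsmul]
        exact W.add_mem (W.smul_mem _ ih) (W.smul_mem _ hx)
    refine ⟨W, Module.Finite.span_of_finite _ ((Finset.finite_toSet _).image _), hstab, ?_⟩
    rcases Nat.eq_zero_or_pos d with h0 | h0
    · subst h0; exact hd
    · exact hS 0 h0
  · classical
    rintro ⟨W, hW, hs, hα⟩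
    have hmem : ∀ i, shift^[i] α ∈ W := by
      intro i
      induction i with
      | zero => exact hα
      | succ i ih => rw [Function.iterate_succ_apply']; exact hs _ ih
    have hnot : ¬ LinearIndependent Kᵐᵒᵖ (fun i : ℕ => (⟨shift^[i] α, hmem i⟩ : W)) := by
      intro hli
      have := hli.finite
      exact not_finite ℕ
    rw [linearIndependent_iff'] at hnot
    push Not at hnot
    obtain ⟨s, g, hsum, j, hj, hgj⟩ := hnot
    let T := s.filter (fun i => g i ≠ 0)
    have hT : T.Nonempty := ⟨j, by simp [T, hj, hgj]⟩
    let d := T.max' hT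
    have hdT : d ∈ T := T.max'_mem hT
    refine ⟨d, fun i => if i ∈ T then (g i).unop else 0, ?_, ?_⟩
    · simp only [hdT, if_true]
      have : g d ≠ 0 := (Finset.mem_filter.mp hdT).2
      simpa using this
    · have h1 : ∑ i ∈ s, g i • shift^[i] α = 0 := by
        simpa using congrArg (Subtype.val) hsum
      have h2 : ∑ i ∈ T, g i • shift^[i] α = 0 := by
        rw [← h1]
        refine Finset.sum_subset (Finset.filter_subset _ _) fun i hi hiT => ?_
        have : g i = 0 := by
          by_contra hne
          exact hiT (Finset.mem_filter.mpr ⟨hi, hne⟩)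
        rw [this, zero_smul]
      rw [← h2]
      symm
      have hsub : T ⊆ Finset.range (d + 1) := fun i hi =>
        Finset.mem_range.mpr (Nat.lt_succ_of_le (T.le_max' i hi))
      rw [← Finset.sum_subset hsub (f := fun i =>
        target (if i ∈ T then (g i).unop else 0) * shift^[i] α)]
      · refine Finset.sum_congr rfl fun i hi => ?_
        rw [if_pos hi]
        rfl
      · intro i _ hi
        rw [if_neg hi, map_zero, zero_mul]

end Hurwitz

open Hurwitz

/-- The two-sided `K`-vector space of differentially recursive sequences, as a left subspace of
the Hurwitz series. -/
def Dlin (K : Type u) [Field K] [Differential K] : Submodule K (Hurwitz K) where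
  carrier := {α | IsDiffRecursive α}
  add_mem' := by
    intro α β hα hβ
    obtain ⟨V, hV, hVs, hαV⟩ := (isDiffRecursive_iff α).mp hα
    obtain ⟨W, hW, hWs, hβW⟩ := (isDiffRecursive_iff β).mp hβ
    refine (isDiffRecursive_iff _).mpr ⟨V ⊔ W, inferInstance, fun γ hγ => ?_,
      Submodule.add_mem_sup hαV hβW⟩
    obtain ⟨v, hv, w, hw, rfl⟩ := Submodule.mem_sup.mp hγ
    rw [map_add]
    exact Submodule.add_mem_sup (hVs v hv) (hWs w hw)
  zero_mem' := (isDiffRecursive_iff _).mpr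
    ⟨⊥, inferInstance, by simp, Submodule.zero_mem _⟩
  smul_mem' := by
    rintro x α ⟨d, c, hc, h⟩
    refine ⟨d, c, hc, ?_⟩
    have h1 : ∀ i, shift^[i] (x • α) = source x * shift^[i] α := by
      intro i
      induction i with
      | zero => exact smul_eq x α
      | succ i ih =>
        rw [Function.iterate_succ_apply', Function.iterate_succ_apply', ih, ← smul_eq, ← smul_eq,
          map_smul]
    simp only [h1]
    rw [← mul_zero (source x), ← h, Finset.mul_sum]
    exact Finset.sum_congr rfl fun i _ => by ring

namespace Dlin

variable {K : Type u} [Field K] [Differential K]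

theorem rsmul_mem (α : Dlin K) (y : Kᵐᵒᵖ) : y • (α : Hurwitz K) ∈ Dlin K := by
  obtain ⟨W, hW, hWs, hα⟩ := (isDiffRecursive_iff (α : Hurwitz K)).mp α.2
  exact (isDiffRecursive_iff _).mpr ⟨W, hW, hWs, W.smul_mem y hα⟩

/-- The right action of `K` on `Dlin K` is the one of the Hurwitz series. -/
instance : Module Kᵐᵒᵖ (Dlin K) where
  smul y α := ⟨y • (α : Hurwitz K), rsmul_mem α y⟩
  one_smul α := Subtype.ext (one_smul _ (α : Hurwitz K))
  mul_smul x y α := Subtype.ext (mul_smul x y (α : Hurwitz K))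
  smul_zero x := Subtype.ext (smul_zero x)
  smul_add x α β := Subtype.ext (smul_add x (α : Hurwitz K) (β : Hurwitz K))
  add_smul x y α := Subtype.ext (add_smul x y (α : Hurwitz K))
  zero_smul α := Subtype.ext (zero_smul _ (α : Hurwitz K))

theorem coe_rsmul (α : Dlin K) (y : Kᵐᵒᵖ) :
    ((y • α : Dlin K) : Hurwitz K) = y • (α : Hurwitz K) := rfl

instance : SMulCommClass K Kᵐᵒᵖ (Dlin K) where
  smul_comm x y α := Subtype.ext (smul_comm x y (α : Hurwitz K))

end Dlin

end Hurwitz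

/-! ## The ring of differential operators `K[Y; ∂]` -/

section Ore

open Polynomial

/-- The Ore extension `U = K[Y; ∂]`. The element `∑ Y^i c_i` (coefficients on the right) is stored
as the polynomial `∑ c_i X^i`. -/
@[ext]
structure Ore (K : Type u) [Field K] where
  /-- The right coefficients. -/
  toPoly : K[X]

namespace Ore

variable {K : Type u} [Field K]

/-- Elements of `U` as right linear combinations of powers of `Y`. -/
def equivPoly : Ore K ≃ K[X] := ⟨toPoly, mk, fun _ => rfl, fun _ => rfl⟩

instance : AddCommGroup (Ore K) := equivPoly.addCommGroup

theorem add_toPoly (u v : Ore K) : (u + v).toPoly = u.toPoly + v.toPoly := rfl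

theorem zero_toPoly : (0 : Ore K).toPoly = 0 := rfl

variable [Differential K]

/-- The normal form of `a Y^n`, from the rule `a Y = Y a + ∂ a`. -/
def scalPow : ℕ → K → K[X]
  | 0, a => C a
  | n + 1, a => X * scalPow n a + scalPow n a′

theorem scalPow_add (n : ℕ) (a b : K) : scalPow n (a + b) = scalPow n a + scalPow n b := by
  induction n generalizing a b with
  | zero => exact C_add
  | succ n ih => simp only [scalPow, map_add, ih]; ring

/-- The explicit form `a Y^n = ∑_k (n choose k) Y^k ∂^{n-k}(a)`. -/
theorem scalPow_eq (n : ℕ) (a : K) : scalPow n a = ∑ k ∈ Finset.range (n + 1),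
    (n.choose k : K[X]) * (X ^ k * C ((Differential.deriv (R := K))^[n - k] a)) := by
  induction n generalizing a with
  | zero => simp [scalPow]
  | succ n ih =>
    rw [Finset.sum_choose_succ_mul
      (fun i j => X ^ i * C ((Differential.deriv (R := K))^[j] a)) n, scalPow, ih, ih, add_comm]
    congr 1
    · refine Finset.sum_congr rfl fun k hk => ?_
      rw [Nat.succ_sub (Nat.lt_succ_iff.mp (Finset.mem_range.mp hk)), Function.iterate_succ_apply]
    · rw [Finset.mul_sum]
      exact Finset.sum_congr rfl fun k _ => by ring

/-- Left multiplication by the scalar `a`, on normal forms. -/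
def scal (a : K) : K[X] →ₗ[K] K[X] :=
  Polynomial.lsum fun n => LinearMap.toSpanSingleton K K[X] (scalPow n a)

theorem scal_X_pow (a : K) (n : ℕ) : scal a (X ^ n) = scalPow n a := by
  rw [scal, Polynomial.lsum_apply, ← monomial_one_right_eq_X_pow, sum_monomial_index _ _ (by simp)]
  simp

theorem scal_ext {f g : K[X] →ₗ[K] K[X]} (h : ∀ n : ℕ, f (X ^ n) = g (X ^ n)) : f = g := by
  refine Polynomial.lhom_ext' fun n => LinearMap.ext_ring ?_
  simpa [monomial_one_right_eq_X_pow] using h n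

theorem scal_add (a b : K) : scal (a + b) = scal a + scal b :=
  scal_ext fun n => by simp only [LinearMap.add_apply, scal_X_pow, scalPow_add]

theorem scal_zero : scal (0 : K) = 0 := by
  have h := scal_add (0 : K) 0
  rw [add_zero] at h
  exact left_eq_add.mp h

theorem scal_X_mul (a : K) (p : K[X]) : scal a (X * p) = X * scal a p + scal a′ p := by
  have : scal a ∘ₗ LinearMap.mulLeft K X = LinearMap.mulLeft K X ∘ₗ scal a + scal a′ :=
    scal_ext fun n => by
      simp only [LinearMap.comp_apply, LinearMap.add_apply, LinearMap.mulLeft_apply, ← pow_succ',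
        scal_X_pow, scalPow]
  exact LinearMap.congr_fun this p

theorem scal_C (a b : K) : scal a (C b) = C (a * b) := by
  have := scal_X_pow a 0
  rw [← mul_one (C b), ← smul_eq_C_mul, map_smul, ← pow_zero X, this]
  simp [scalPow, smul_eq_C_mul, mul_comm]

theorem scal_one : scal (1 : K) = LinearMap.id := by
  refine scal_ext fun n => ?_
  induction n with
  | zero => rw [pow_zero, ← C_1, scal_C]; simp
  | succ n ih =>
    rw [pow_succ', scal_X_mul, ih, Derivation.map_one_eq_zero, scal_zero]
    simp

theorem scal_mul (a b : K) : scal (a * b) = scal a ∘ₗ scal b := by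
  have : ∀ n : ℕ, ∀ a b : K, scal (a * b) (X ^ n) = scal a (scal b (X ^ n)) := by
    intro n
    induction n with
    | zero => intro a b; rw [pow_zero, ← C_1, scal_C, scal_C, scal_C, mul_assoc]
    | succ n ih =>
      intro a b
      have h1 : (a * b)′ = a′ * b + a * b′ := by
        rw [Derivation.leibniz]; simp only [smul_eq_mul]; ring
      rw [pow_succ', scal_X_mul, scal_X_mul, map_add, scal_X_mul, h1, scal_add,
        LinearMap.add_apply, ih, ih, ih]
      ring
  exact scal_ext fun n => this n a b

/-- Left multiplication by `∑ Y^i c_i`, on normal forms. -/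
def leftMul : K[X] →+ Module.End K K[X] where
  toFun p := p.sum fun i c => LinearMap.mulLeft K (X ^ i) ∘ₗ scal c
  map_zero' := sum_zero_index _
  map_add' p q := sum_add_index p q _ (fun i => by rw [scal_zero, LinearMap.comp_zero])
    (fun i a b => by rw [scal_add, LinearMap.comp_add])

theorem leftMul_monomial (n : ℕ) (a : K) (q : K[X]) :
    leftMul (monomial n a) q = X ^ n * scal a q := by
  change ((monomial n a).sum fun i c => LinearMap.mulLeft K (X ^ i) ∘ₗ scal c) q = _
  rw [sum_monomial_index _ _ (by rw [scal_zero, LinearMap.comp_zero])]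
  rfl

theorem leftMul_C (a : K) (q : K[X]) : leftMul (C a) q = scal a q := by
  rw [← monomial_zero_left, leftMul_monomial, pow_zero, one_mul]

theorem leftMul_X_mul (p q : K[X]) : leftMul (X * p) q = X * leftMul p q := by
  induction p using Polynomial.induction_on' with
  | add p r hp hr => rw [mul_add, map_add, map_add, LinearMap.add_apply, LinearMap.add_apply, hp,
      hr, mul_add]
  | monomial n a =>
    rw [← pow_one X, X_pow_mul_monomial, leftMul_monomial, leftMul_monomial]
    ring

theorem leftMul_X_pow_mul (n : ℕ) (p q : K[X]) : leftMul (X ^ n * p) q = X ^ n * leftMul p q := by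
  induction n with
  | zero => simp
  | succ n ih => rw [pow_succ', mul_assoc, leftMul_X_mul, ih, mul_assoc]

theorem leftMul_scal (a : K) (p q : K[X]) : leftMul (scal a p) q = scal a (leftMul p q) := by
  have key : ∀ (n : ℕ) (a b : K), leftMul (scal a (X ^ n * C b)) q =
      scal a (leftMul (X ^ n * C b) q) := by
    intro n
    induction n with
    | zero => intro a b; rw [pow_zero, one_mul, scal_C, leftMul_C, leftMul_C, scal_mul]; rfl
    | succ n ih =>
      intro a b
      rw [pow_succ', mul_assoc, scal_X_mul, map_add, LinearMap.add_apply, leftMul_X_mul,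
        leftMul_X_mul, ih, ih, scal_X_mul]
  induction p using Polynomial.induction_on' with
  | add p r hp hr => simp only [map_add, LinearMap.add_apply, hp, hr]
  | monomial n b => rw [← C_mul_X_pow_eq_monomial, mul_comm]; exact key n a b

theorem leftMul_leftMul (p q r : K[X]) : leftMul (leftMul p q) r = leftMul p (leftMul q r) := by
  induction p using Polynomial.induction_on' with
  | add p s hp hs => simp only [map_add, LinearMap.add_apply, hp, hs]
  | monomial n b =>
    rw [leftMul_monomial, leftMul_monomial, leftMul_X_pow_mul, leftMul_scal]

theorem leftMul_one (p : K[X]) : leftMul p 1 = p := by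
  induction p using Polynomial.induction_on' with
  | add p s hp hs => rw [map_add, LinearMap.add_apply, hp, hs]
  | monomial n b =>
    rw [leftMul_monomial, ← C_1, scal_C, mul_one, ← C_mul_X_pow_eq_monomial, mul_comm]

instance : Mul (Ore K) := ⟨fun u v => ⟨leftMul u.toPoly v.toPoly⟩⟩

instance : One (Ore K) := ⟨⟨1⟩⟩

theorem mul_toPoly (u v : Ore K) : (u * v).toPoly = leftMul u.toPoly v.toPoly := rfl

instance : Ring (Ore K) :=
  { (inferInstance : AddCommGroup (Ore K)) with
    mul := (· * ·)
    one := 1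
    left_distrib := fun u v w => Ore.ext (map_add (leftMul u.toPoly) _ _)
    right_distrib := fun u v w => Ore.ext (by
      rw [mul_toPoly, add_toPoly, add_toPoly, map_add, LinearMap.add_apply]; rfl)
    zero_mul := fun u => Ore.ext (by
      rw [mul_toPoly, zero_toPoly, map_zero, LinearMap.zero_apply])
    mul_zero := fun u => Ore.ext (map_zero (leftMul u.toPoly))
    mul_assoc := fun u v w => Ore.ext (leftMul_leftMul _ _ _)
    one_mul := fun u => Ore.ext (by
      change leftMul 1 u.toPoly = u.toPoly
      rw [← C_1, leftMul_C, scal_one, LinearMap.id_apply])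
    mul_one := fun u => Ore.ext (leftMul_one _) }

/-- The inclusion `τ` of `K` in `U`. -/
def tau : K →+* Ore K where
  toFun a := ⟨C a⟩
  map_one' := rfl
  map_mul' a b := Ore.ext (by rw [mul_toPoly, leftMul_C, scal_C])
  map_zero' := Ore.ext C_0
  map_add' a b := Ore.ext C_add

/-- The generator `Y` of `U`. -/
def Y : Ore K := ⟨X⟩

/-- The defining relation of `U`. -/
theorem tau_mul_Y (a : K) : tau a * Y = Y * tau a + tau a′ := by
  refine Ore.ext ?_
  have h := scal_X_pow a 1
  rw [pow_one] at h
  rw [add_toPoly, mul_toPoly, mul_toPoly]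
  change leftMul (C a) X = leftMul X (C a) + C a′
  rw [leftMul_C, h, ← mul_one X, leftMul_X_mul, ← C_1, leftMul_C, scal_one]
  simp [scalPow]

theorem Y_pow_toPoly (n : ℕ) : ((Y : Ore K) ^ n).toPoly = X ^ n := by
  induction n with
  | zero => rfl
  | succ n ih =>
    rw [pow_succ', mul_toPoly, ih]
    change leftMul X (X ^ n) = _
    rw [← mul_one (X : K[X]), leftMul_X_mul, ← C_1, leftMul_C, scal_one, LinearMap.id_apply, C_1,
      mul_one, pow_succ']

theorem mul_tau_toPoly (u : Ore K) (a : K) : (u * tau a).toPoly = a • u.toPoly := by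
  rw [mul_toPoly]
  change leftMul u.toPoly (C a) = _
  rw [← mul_one (C a), ← smul_eq_C_mul, map_smul, leftMul_one]

/-- `U` as a right `K`-vector space: `u <• x = u * τ x`. -/
instance : Module Kᵐᵒᵖ (Ore K) := Module.compHom (Ore K) (RingHom.op (tau (K := K)))

theorem rsmul_eq (u : Ore K) (x : K) : u <• x = u * tau x := rfl

/-- `U* = Hom_K(U, K)`, the right `K`-linear maps from `U` to `K`. -/
abbrev Dual (K : Type u) [Field K] [Differential K] : Type u := Ore K →ₗ[Kᵐᵒᵖ] K

/-- The right linear functional `f_α` on `U` with `f_α(Y^n) = α n`. -/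
def Dual.ofSeq (α : Hurwitz K) : Dual K where
  toFun u := u.toPoly.sum fun n c => α.coeff n * c
  map_add' u v := sum_add_index _ _ _ (fun n => mul_zero _) (fun n a b => mul_add _ _ _)
  map_smul' x u := by
    change (u * tau x.unop).toPoly.sum _ = _
    rw [mul_tau_toPoly, sum_smul_index _ _ _ (fun n => mul_zero _)]
    change _ = u.toPoly.sum (fun n c => α.coeff n * c) * x.unop
    rw [sum_def, sum_def, Finset.sum_mul]
    exact Finset.sum_congr rfl fun n _ => by ring

theorem Dual.ofSeq_Y_pow (α : Hurwitz K) (n : ℕ) : Dual.ofSeq α (Y ^ n) = α.coeff n := by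
  change ((Y : Ore K) ^ n).toPoly.sum _ = _
  rw [Y_pow_toPoly, ← monomial_one_right_eq_X_pow]
  exact (sum_monomial_index (1 : K) (fun n c => α.coeff n * c) (mul_zero _)).trans (mul_one _)

/-- The convolution product of `U*`, dual to `Δ(Y^n) = ∑_k (n choose k) Y^k ⊗ Y^{n-k}`. -/
def Dual.conv (f g : Dual K) : Dual K :=
  Dual.ofSeq ⟨fun n => ∑ k ∈ Finset.range (n + 1),
    (n.choose k : K) * (f (Y ^ k) * g (Y ^ (n - k)))⟩

/-- The unit of the convolution product: the counit `Y^n ↦ δ_{n,0}` of `U`. -/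
def Dual.unit : Dual K := Dual.ofSeq ⟨fun n => if n = 0 then 1 else 0⟩

end Ore
end Ore

/-! ## The universal property of the dual coring -/

section Saft

variable {K : Type u} [Field K] [Differential K]

open Ore

/-- The relations linking a `K`-coring `C` to `U*` through `ξ : C → U*`; the first one is
`ξ(z)(u v) = ∑ ξ(z₁)(τ(ξ(z₂)(u)) v)`. -/
structure SaftRel {C : Type v} [AddCommGroup C] [Module K C] [Module Kᵐᵒᵖ C]
    [SMulCommClass K Kᵐᵒᵖ C] (Γ : Coring K C) (ξ : C →+ Dual K) : Prop where
  mul : ∀ (z : C) (m : ℕ) (z₁ z₂ : Fin m → C), Γ.comul z = ∑ i, BiTensor.tmul K (z₁ i) (z₂ i) →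
    ∀ u v : Ore K, ξ z (u * v) = ∑ i, ξ (z₁ i) (tau (ξ (z₂ i) u) * v)
  one : ∀ z : C, ξ z 1 = Γ.counit z
  bilin : ∀ (x y : K) (z : C) (u : Ore K), ξ (x • z <• y) u = x * ξ z (tau y * u)

/-- `(V, ξ)` is the dual coring `U^•`: a `K`-coring with a map to `U*` satisfying the relations,
through which every such map from a `K`-coring factors by a unique coring homomorphism. -/
def IsSaftDual {V : Type w} [AddCommGroup V] [Module K V] [Module Kᵐᵒᵖ V]
    [SMulCommClass K Kᵐᵒᵖ V] (Γ : Coring K V) (ξ : V →+ Dual K) : Prop :=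
  SaftRel Γ ξ ∧
  ∀ (C : Type v) [AddCommGroup C] [Module K C] [Module Kᵐᵒᵖ C] [SMulCommClass K Kᵐᵒᵖ C]
    (Λ : Coring K C) (f : C →+ Dual K), SaftRel Λ f →
    ∃! g : BimodHom K C V, IsCoringHom Λ Γ g ∧ ∀ c, ξ (g c) = f c

/-- The multiplicative structure of a Hopf algebroid `V` is the one induced by the convolution
algebra `U*` through `ξ : V → U*`. -/
structure RespectsConv {V : Type w} [AddCommGroup V] [Module K V] [Module Kᵐᵒᵖ V]
    [SMulCommClass K Kᵐᵒᵖ V] (H : HopfAlgebroid K V) (ξ : V →+ Dual K) : Prop where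
  one : ξ H.one = Dual.unit
  mul : ∀ a b, ξ (H.mul a b) = Dual.conv (ξ a) (ξ b)

/-- The inclusion `α ↦ f_α` of `Dlin K` in `U*`. -/
def Dlin.xi : Dlin K →+ Dual K where
  toFun α := Dual.ofSeq (α : Hurwitz K)
  map_zero' := by
    refine LinearMap.ext fun u => ?_
    change u.toPoly.sum (fun n c => (0 : K) * c) = 0
    simp [Polynomial.sum_def]
  map_add' α β := by
    refine LinearMap.ext fun u => ?_
    change u.toPoly.sum (fun n c => ((α : Hurwitz K).coeff n + (β : Hurwitz K).coeff n) * c) =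
      u.toPoly.sum (fun n c => (α : Hurwitz K).coeff n * c) +
        u.toPoly.sum (fun n c => (β : Hurwitz K).coeff n * c)
    simp only [Polynomial.sum_def, ← Finset.sum_add_distrib, add_mul]

/-- The Hopf algebroid structure of the differentially recursive sequences. -/
structure IsDlinHopf (H : HopfAlgebroid K (Dlin K)) : Prop where
  one : (H.one : Hurwitz K) = 1
  mul : ∀ α β, (H.mul α β : Hurwitz K) = (α : Hurwitz K) * (β : Hurwitz K)
  counit : ∀ α : Dlin K, H.counit α = (α : Hurwitz K).coeff 0
  /-- `Δ(α) = ∑_{i<d} N^i(α) ⊗ (y_i^*(y_n))_n`, where `P = Y^d - ∑_{i<d} Y^i c_i` gives an operator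
  killing `α`, and `y_n = ∑_{i<d} y_i y_i^*(y_n)` is the class of `Y^n` in `U / P U`. -/
  comul : ∀ (α : Dlin K) (d : ℕ) (c : Fin d → K),
    Hurwitz.shift^[d] (α : Hurwitz K) =
      ∑ i, Hurwitz.target (c i) * Hurwitz.shift^[i] (α : Hurwitz K) →
    ∃ a o : Fin d → Dlin K,
      (∀ i, (a i : Hurwitz K) = Hurwitz.shift^[i] (α : Hurwitz K)) ∧
      (∀ n : ℕ, ∃ q : Ore K, Y ^ n = ∑ i : Fin d, Y ^ (i : ℕ) * tau ((o i : Hurwitz K).coeff n) +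
        (Y ^ d - ∑ i : Fin d, Y ^ (i : ℕ) * tau (c i)) * q) ∧
      H.comul α = ∑ i, BiTensor.tmul K (a i) (o i)
  antipode : ∀ (α : Dlin K) (n : ℕ), (H.antipode α : Hurwitz K).coeff n =
    ∑ k ∈ Finset.range (n + 1), (n.choose k : K) * ((-1) ^ (n - k) *
      (Differential.deriv (R := K))^[k] ((α : Hurwitz K).coeff (n - k)))

end Saft

/-! ## The finite dual `U°` -/

section FiniteDual

/-- Finite-dimensional differential `K`-vector spaces. -/
structure DiffMod (K : Type u) [Field K] [Differential K] : Type (u + 1) where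
  carrier : Type u
  [addCommGroup : AddCommGroup carrier]
  [module : Module K carrier]
  [finite : Module.Finite K carrier]
  der : carrier →+ carrier
  leibniz : ∀ (x : K) (m : carrier), der (x • m) = x • der m + x′ • m

namespace DiffMod

attribute [instance] addCommGroup module finite

variable {K : Type u} [Field K] [Differential K]

instance : CoeSort (DiffMod K) (Type u) := ⟨carrier⟩

/-- The differential vector space `(K, ∂)`. -/
def unit (K : Type u) [Field K] [Differential K] : DiffMod K where
  carrier := K
  der := (Differential.deriv (R := K)).toLinearMap.toAddMonoidHom
  leibniz x m := by
    change (x * m)′ = x * m′ + x′ * m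
    rw [Derivation.leibniz]; simp only [smul_eq_mul]; ring

/-- The map `m ⊗ n ↦ ∂ m ⊗ n + m ⊗ ∂ n`. -/
def tensorDer (M N : DiffMod K) : M ⊗[K] N →+ M ⊗[K] N :=
  TensorProduct.liftAddHom
    (AddMonoidHom.mk'
      (fun m => AddMonoidHom.mk' (fun n => M.der m ⊗ₜ[K] n + m ⊗ₜ[K] N.der n) (fun n n' => by
        rw [map_add, TensorProduct.tmul_add, TensorProduct.tmul_add, add_add_add_comm]))
      (fun m m' => by
        ext n
        change M.der (m + m') ⊗ₜ[K] n + (m + m') ⊗ₜ[K] N.der n =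
          (M.der m ⊗ₜ[K] n + m ⊗ₜ[K] N.der n) + (M.der m' ⊗ₜ[K] n + m' ⊗ₜ[K] N.der n)
        rw [map_add, TensorProduct.add_tmul, TensorProduct.add_tmul, add_add_add_comm]))
    (fun x m n => by
      change M.der (x • m) ⊗ₜ[K] n + (x • m) ⊗ₜ[K] N.der n =
        M.der m ⊗ₜ[K] (x • n) + m ⊗ₜ[K] N.der (x • n)
      rw [leibniz, leibniz, TensorProduct.add_tmul, TensorProduct.tmul_add,
        TensorProduct.smul_tmul, TensorProduct.smul_tmul x′, TensorProduct.smul_tmul x m,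
        add_assoc, add_comm (m ⊗ₜ[K] (x′ • n))])

theorem tensorDer_tmul (M N : DiffMod K) (m : M) (n : N) :
    tensorDer M N (m ⊗ₜ[K] n) = M.der m ⊗ₜ[K] n + m ⊗ₜ[K] N.der n := rfl

/-- The tensor product `M ⊗_K N` with `∂(m ⊗ n) = ∂ m ⊗ n + m ⊗ ∂ n`. -/
def tensor (M N : DiffMod K) : DiffMod K where
  carrier := M ⊗[K] N
  der := tensorDer M N
  leibniz x z := by
    induction z using TensorProduct.induction_on with
    | zero => simp only [smul_zero, map_zero, add_zero]
    | tmul m n =>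
      rw [TensorProduct.smul_tmul', tensorDer_tmul, tensorDer_tmul, leibniz,
        TensorProduct.add_tmul, smul_add, TensorProduct.smul_tmul', TensorProduct.smul_tmul',
        TensorProduct.smul_tmul', add_right_comm]
    | add a b ha hb =>
      rw [smul_add, map_add, map_add, ha, hb, smul_add, smul_add, add_add_add_comm]

/-- The dual `M^*` with `∂(φ) = ∂ ∘ φ - φ ∘ ∂`. -/
def dual (M : DiffMod K) : DiffMod K where
  carrier := Module.Dual K M
  der := AddMonoidHom.mk'
    (fun φ =>
      { toFun := fun m => (φ m)′ - φ (M.der m)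
        map_add' := fun m m' => by simp only [map_add]; ring
        map_smul' := fun x m => by
          simp only [leibniz, map_add, map_smul, smul_eq_mul, RingHom.id_apply, Derivation.leibniz]
          ring })
    (fun φ ψ => by
      ext m
      change (φ m + ψ m)′ - (φ (M.der m) + ψ (M.der m)) =
        ((φ m)′ - φ (M.der m)) + ((ψ m)′ - ψ (M.der m))
      rw [map_add]; ring)
  leibniz x φ := by
    ext m
    change (x * φ m)′ - x * φ (M.der m) = x * ((φ m)′ - φ (M.der m)) + x′ * φ m
    rw [Derivation.leibniz]; simp only [smul_eq_mul]; ring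

/-- Morphisms of differential `K`-vector spaces. -/
structure Hom (M N : DiffMod K) where
  toLin : M →ₗ[K] N
  comm : ∀ m, toLin (M.der m) = N.der (toLin m)

end DiffMod

variable (K : Type u) [Field K] [Differential K]

/-- The abelian group `M^* ⊗ M`. -/
def CircSummand (M : DiffMod K) : Type u := Module.Dual K M ⊗[ℤ] M

instance (M : DiffMod K) : AddCommGroup (CircSummand K M) :=
  inferInstanceAs (AddCommGroup (Module.Dual K M ⊗[ℤ] M))

/-- The direct sum `⨁_M M^* ⊗ M` over all finite-dimensional differential `K`-vector spaces. -/
def PreCirc : Type (u + 1) := DirectSum (DiffMod K) (CircSummand K)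

instance : AddCommGroup (PreCirc K) :=
  inferInstanceAs (AddCommGroup (DirectSum (DiffMod K) (CircSummand K)))

variable {K}

/-- The element `φ ⊗ m` of `M^* ⊗ M`. -/
def CircSummand.tmul {M : DiffMod K} (φ : Module.Dual K M) (m : M) : CircSummand K M := φ ⊗ₜ[ℤ] m

open Classical in
/-- The inclusion of the summand of `M`. -/
def PreCirc.of (M : DiffMod K) : CircSummand K M →+ PreCirc K := DirectSum.of (CircSummand K) M

/-- The element `φ ⊗ m` in the summand of `M`. -/
def PreCirc.mk (M : DiffMod K) (φ : Module.Dual K M) (m : M) : PreCirc K :=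
  PreCirc.of M (CircSummand.tmul φ m)

variable (K) in
/-- The subgroup generated by the elements `ψ ⊗ f m - ψ f ⊗ m`, for all morphisms `f : M → N` of
differential vector spaces. The case of endomorphisms turns `M^* ⊗ M` into the tensor product
over the ring of differential endomorphisms of `M`. -/
def circRel : AddSubgroup (PreCirc K) :=
  AddSubgroup.closure {z | ∃ (M N : DiffMod K) (f : DiffMod.Hom M N) (ψ : Module.Dual K N) (m : M),
    z = PreCirc.mk N ψ (f.toLin m) - PreCirc.mk M (ψ ∘ₗ f.toLin) m}

variable (K) in
/-- The finite dual `U°` as an abelian group. -/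
def Circ : Type (u + 1) := PreCirc K ⧸ circRel K

namespace Circ

instance : AddCommGroup (Circ K) := inferInstanceAs (AddCommGroup (PreCirc K ⧸ circRel K))

variable (K) in
/-- The projection `⨁_M M^* ⊗ M → U°`. -/
def proj : PreCirc K →+ Circ K := QuotientAddGroup.mk' (circRel K)

/-- The class of `φ ⊗ m`. -/
def mk (M : DiffMod K) (φ : Module.Dual K M) (m : M) : Circ K := proj K (PreCirc.mk M φ m)

theorem mk_hom {M N : DiffMod K} (f : DiffMod.Hom M N) (ψ : Module.Dual K N) (m : M) :
    mk N ψ (f.toLin m) = mk M (ψ ∘ₗ f.toLin) m := by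
  refine sub_eq_zero.mp ?_
  rw [mk, mk, ← map_sub]
  exact (QuotientAddGroup.eq_zero_iff _).mpr
    (AddSubgroup.subset_closure ⟨M, N, f, ψ, m, rfl⟩)

theorem mk_add_left (M : DiffMod K) (φ ψ : Module.Dual K M) (m : M) :
    mk M (φ + ψ) m = mk M φ m + mk M ψ m := by
  rw [mk, mk, mk, ← map_add, PreCirc.mk, PreCirc.mk, PreCirc.mk, ← map_add]
  exact congrArg (fun t => proj K (PreCirc.of M t)) (TensorProduct.add_tmul φ ψ m)

theorem mk_add_right (M : DiffMod K) (φ : Module.Dual K M) (m n : M) :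
    mk M φ (m + n) = mk M φ m + mk M φ n := by
  rw [mk, mk, mk, ← map_add, PreCirc.mk, PreCirc.mk, PreCirc.mk, ← map_add]
  exact congrArg (fun t => proj K (PreCirc.of M t)) (TensorProduct.tmul_add φ m n)

theorem induction_on {p : Circ K → Prop} (z : Circ K) (zero : p 0)
    (mk : ∀ M φ m, p (mk M φ m)) (add : ∀ a b, p a → p b → p (a + b)) : p z := by
  classical
  have h1 : ∀ (M : DiffMod K) (t : Module.Dual K M ⊗[ℤ] M),
      p (proj K (PreCirc.of M t)) := by
    intro M t
    induction t using TensorProduct.induction_on with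
    | zero =>
      exact (congrArg p ((congrArg _ (map_zero (PreCirc.of M))).trans (map_zero _))).mpr zero
    | tmul φ m => exact mk M φ m
    | add a b ha hb =>
      exact (congrArg p ((congrArg _ (map_add (PreCirc.of M) a b)).trans (map_add _ _ _))).mpr
        (add _ _ ha hb)
  have h2 : ∀ w : PreCirc K, p (proj K w) := fun w =>
    DirectSum.induction_on w ((congrArg p (map_zero _)).mpr zero) h1
      (fun a b ha hb => (congrArg p (map_add _ a b)).mpr (add _ _ ha hb))
  exact QuotientAddGroup.induction_on z h2

open Classical in
/-- The additive map out of `⨁_M M^* ⊗ M` induced by a family of biadditive maps. -/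
def preLift {A : Type*} [AddCommGroup A] (F : ∀ M : DiffMod K, Module.Dual K M →+ M →+ A) :
    PreCirc K →+ A :=
  DirectSum.toAddMonoid (β := CircSummand K) fun M =>
    TensorProduct.liftAddHom (R := ℤ) (F M)
      (fun r φ m => by rw [map_zsmul, map_zsmul, AddMonoidHom.zsmul_apply])

theorem preLift_mk {A : Type*} [AddCommGroup A] (F : ∀ M : DiffMod K, Module.Dual K M →+ M →+ A)
    (M : DiffMod K) (φ : Module.Dual K M) (m : M) : preLift F (PreCirc.mk M φ m) = F M φ m := by
  classical
  exact DirectSum.toAddMonoid_of (β := CircSummand K) _ M (CircSummand.tmul φ m)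

/-- The additive map out of `U°` induced by a family of biadditive maps compatible with all
morphisms of differential vector spaces. -/
def lift {A : Type*} [AddCommGroup A] (F : ∀ M : DiffMod K, Module.Dual K M →+ M →+ A)
    (hF : ∀ (M N : DiffMod K) (f : DiffMod.Hom M N) (ψ : Module.Dual K N) (m : M),
      F N ψ (f.toLin m) = F M (ψ ∘ₗ f.toLin) m) : Circ K →+ A :=
  QuotientAddGroup.lift (circRel K) (preLift F) (by
    rw [circRel, AddSubgroup.closure_le]
    rintro _ ⟨M, N, f, ψ, m, rfl⟩
    change preLift F _ = (0 : A)
    rw [map_sub, preLift_mk, preLift_mk, hF, sub_self])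

theorem lift_mk {A : Type*} [AddCommGroup A] (F : ∀ M : DiffMod K, Module.Dual K M →+ M →+ A)
    (hF : ∀ (M N : DiffMod K) (f : DiffMod.Hom M N) (ψ : Module.Dual K N) (m : M),
      F N ψ (f.toLin m) = F M (ψ ∘ₗ f.toLin) m) (M : DiffMod K) (φ : Module.Dual K M) (m : M) :
    lift F hF (mk M φ m) = F M φ m := preLift_mk F M φ m

/-- `φ ⊗ m ↦ (x φ) ⊗ m`. -/
def lact (x : K) : Circ K →+ Circ K :=
  lift (fun M => AddMonoidHom.mk' (fun φ => AddMonoidHom.mk' (fun m => mk M (x • φ) m)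
        (fun m n => mk_add_right M _ m n))
      (fun φ ψ => by ext m; exact (congrArg (mk M · m) (smul_add x φ ψ)).trans (mk_add_left M _ _ m)))
    (fun M N f ψ m => mk_hom f (x • ψ) m)

theorem lact_mk (x : K) (M : DiffMod K) (φ : Module.Dual K M) (m : M) :
    lact x (mk M φ m) = mk M (x • φ) m := lift_mk _ _ _ _ _

/-- `φ ⊗ m ↦ φ ⊗ (m y)`. -/
def ract (y : K) : Circ K →+ Circ K :=
  lift (fun M => AddMonoidHom.mk' (fun φ => AddMonoidHom.mk' (fun m => mk M φ (y • m))
        (fun m n => (congrArg (mk M φ) (smul_add y m n)).trans (mk_add_right M φ _ _)))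
      (fun φ ψ => by ext m; exact mk_add_left M φ ψ _))
    (fun M N f ψ m => by
      change mk N ψ (y • f.toLin m) = mk M (ψ ∘ₗ f.toLin) (y • m)
      rw [← map_smul, mk_hom])

theorem ract_mk (y : K) (M : DiffMod K) (φ : Module.Dual K M) (m : M) :
    ract y (mk M φ m) = mk M φ (y • m) := lift_mk _ _ _ _ _

theorem mk_zero_left (M : DiffMod K) (m : M) : mk M 0 m = 0 := by
  have h := mk_add_left M 0 0 m
  rw [add_zero] at h
  exact left_eq_add.mp h

theorem mk_zero_right (M : DiffMod K) (φ : Module.Dual K M) : mk M φ 0 = 0 := by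
  have h := mk_add_right M φ 0 0
  rw [add_zero] at h
  exact left_eq_add.mp h

/-- `x • (φ ⊗ m) = (x φ) ⊗ m`. -/
instance : Module K (Circ K) where
  smul x z := lact x z
  one_smul z := by
    change lact 1 z = z
    induction z using induction_on with
    | zero => exact map_zero _
    | mk M φ m => rw [lact_mk, one_smul]
    | add a b ha hb => rw [map_add, ha, hb]
  mul_smul x y z := by
    change lact (x * y) z = lact x (lact y z)
    induction z using induction_on with
    | zero => simp only [map_zero]
    | mk M φ m => rw [lact_mk, lact_mk, lact_mk, mul_smul]
    | add a b ha hb => simp only [map_add, ha, hb]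
  smul_zero x := map_zero (lact x)
  smul_add x := map_add (lact x)
  add_smul x y z := by
    change lact (x + y) z = lact x z + lact y z
    induction z using induction_on with
    | zero => simp only [map_zero, add_zero]
    | mk M φ m => rw [lact_mk, lact_mk, lact_mk, add_smul, mk_add_left]
    | add a b ha hb => simp only [map_add, ha, hb]; abel
  zero_smul z := by
    change lact 0 z = 0
    induction z using induction_on with
    | zero => exact map_zero _
    | mk M φ m => rw [lact_mk, zero_smul, mk_zero_left]
    | add a b ha hb => rw [map_add, ha, hb, add_zero]

/-- `(φ ⊗ m) <• y = φ ⊗ (m y)`. -/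
instance : Module Kᵐᵒᵖ (Circ K) where
  smul y z := ract y.unop z
  one_smul z := by
    change ract 1 z = z
    induction z using induction_on with
    | zero => exact map_zero _
    | mk M φ m => rw [ract_mk, one_smul]
    | add a b ha hb => rw [map_add, ha, hb]
  mul_smul x y z := by
    change ract (y.unop * x.unop) z = ract x.unop (ract y.unop z)
    induction z using induction_on with
    | zero => simp only [map_zero]
    | mk M φ m => rw [ract_mk, ract_mk, ract_mk, mul_comm, mul_smul]
    | add a b ha hb => simp only [map_add, ha, hb]
  smul_zero x := map_zero (ract x.unop)
  smul_add x := map_add (ract x.unop)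
  add_smul x y z := by
    change ract (x.unop + y.unop) z = ract x.unop z + ract y.unop z
    induction z using induction_on with
    | zero => simp only [map_zero, add_zero]
    | mk M φ m => rw [ract_mk, ract_mk, ract_mk, add_smul, mk_add_right]
    | add a b ha hb => simp only [map_add, ha, hb]; abel
  zero_smul z := by
    change ract 0 z = 0
    induction z using induction_on with
    | zero => exact map_zero _
    | mk M φ m => rw [ract_mk, zero_smul, mk_zero_right]
    | add a b ha hb => rw [map_add, ha, hb, add_zero]

theorem smul_mk (x : K) (M : DiffMod K) (φ : Module.Dual K M) (m : M) :
    x • mk M φ m = mk M (x • φ) m := lact_mk x M φ m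

theorem mk_rsmul (y : K) (M : DiffMod K) (φ : Module.Dual K M) (m : M) :
    mk M φ m <• y = mk M φ (y • m) := ract_mk y M φ m

instance : SMulCommClass K Kᵐᵒᵖ (Circ K) where
  smul_comm x y z := by
    change lact x (ract y.unop z) = ract y.unop (lact x z)
    induction z using induction_on with
    | zero => simp only [map_zero]
    | mk M φ m => rw [lact_mk, ract_mk, ract_mk, lact_mk]
    | add a b ha hb => simp only [map_add, ha, hb]

end Circ

/-- The functional `ψ ◇ φ : Q ⊗_K P → K`, `q ⊗ p ↦ ψ(q) φ(p)`. -/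
def diamond {P Q : DiffMod K} (ψ : Module.Dual K Q) (φ : Module.Dual K P) :
    Module.Dual K (Q.tensor P) :=
  LinearMap.mul' K K ∘ₗ TensorProduct.map ψ φ

/-- The Hopf algebroid structure of the finite dual `U°`. -/
structure IsCircHopf (H : HopfAlgebroid K (Circ K)) : Prop where
  source : ∀ x : K, x • H.one = Circ.mk (DiffMod.unit K) (LinearMap.toSpanSingleton K K x) (1 : K)
  target : ∀ x : K, H.one <• x = Circ.mk (DiffMod.unit K) LinearMap.id x
  mul : ∀ (P Q : DiffMod K) (φ : Module.Dual K P) (p : P) (ψ : Module.Dual K Q) (q : Q),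
    H.mul (Circ.mk P φ p) (Circ.mk Q ψ q) =
      Circ.mk (Q.tensor P) (diamond ψ φ) (q ⊗ₜ[K] p : Q ⊗[K] P)
  counit : ∀ (M : DiffMod K) (φ : Module.Dual K M) (m : M), H.counit (Circ.mk M φ m) = φ m
  comul : ∀ (M : DiffMod K) (φ : Module.Dual K M) (m : M) (n : ℕ)
    (e : Module.Basis (Fin n) K M),
    H.comul (Circ.mk M φ m) =
      ∑ i, BiTensor.tmul K (Circ.mk M φ (e i)) (Circ.mk M (e.coord i) m)
  antipode : ∀ (M : DiffMod K) (φ : Module.Dual K M) (m : M),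
    H.antipode (Circ.mk M φ m) = Circ.mk M.dual (Module.Dual.eval K M m) φ

end FiniteDual

end DRec

end

/-!
A differentially recursive sequence is the same thing as a matrix coefficient `(φ (∂ⁿ m))ₙ` of a
finite-dimensional differential vector space `M`. Matrix coefficients satisfy a recursion because
their shifts are again matrix coefficients of `M` for the same `φ`
(`DiffMod.isDiffRecursive_coeffSeq`); conversely a recursive sequence is a matrix coefficient of the
companion space `U / P U` of an operator `P` killing it (`IsDiffRecursive.exists_coeffSeq`). In this
description products come from tensor products, the antipode from duals and the comultiplication
from dual bases, so `Dlin K` is closed under all the operations.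

The Hopf algebroid axioms rest on one injectivity statement, `BiTensor.eq_of_slice_eq`: over a
field, an element of `M ⊗_K N` is determined by its contractions with a separating family of
functionals on `N`. For `Dlin K ⊗_K Dlin K` the functionals `β ↦ β n` suffice, and `Δ α` is the only
tensor `∑ α₁ ⊗ α₂` with `∑ α₁ t(α₂ n) = Nⁿ α` for all `n`. Coassociativity and multiplicativity then
become `Nⁿ Nᵐ = Nⁿ⁺ᵐ` and the Leibniz rule for the derivation `N`. The antipode is
`S α = (((∂ - N)ⁿ α)(0))ₙ`. It is governed by `N S = S (∂ - N)`, where `∂ - N` is a derivation too.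

For the universal property, let `f : C → U*` satisfy the relations and let `Δ c = ∑ c₁ ⊗ c₂`. The
relations say that the `n`-th shift of the sequence of `f c` is `∑ f(c₁) t(f(c₂)(Yⁿ))`. All shifts lie
in the right span of the finitely many `f(c₁)`, so `f c` is differentially recursive, and the same
formula identifies its comultiplication. Uniqueness is the injectivity of `Dlin K → U*`.

The map `U° → Dlin K` is onto by the companion spaces. For injectivity, direct sums write every
class as a single `φ ⊗ m`, and if `φ` kills all `∂ⁿ m`, then `φ ⊗ m` is already zero in the summand of
the differential subspace generated by `m`. The Hopf structure of `U°` is transported from `Dlin K`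
along this isomorphism, and that of another SAFT-dual coring along the isomorphism given by the
universal properties. In the latter case it is unique: the map to `U*` is injective, so it fixes the
product, and the antipode of a commutative Hopf algebroid is determined by the remaining structure
(`HopfAlgebroid.antipode_unique`).
-/

noncomputable section

namespace DRec

/-! ### Bimodules and their tensor products -/

section Bimodules

variable {K : Type u} [Field K]

namespace BimodHom

variable {M N P : Type*} [AddCommGroup M] [Module K M] [Module Kᵐᵒᵖ M]
  [AddCommGroup N] [Module K N] [Module Kᵐᵒᵖ N] [AddCommGroup P] [Module K P] [Module Kᵐᵒᵖ P]

theorem ext_apply {f g : BimodHom K M N} (h : ∀ m, f m = g m) : f = g := by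
  obtain ⟨f, hf⟩ := f
  obtain ⟨g, hg⟩ := g
  obtain rfl : f = g := LinearMap.ext h
  rfl

theorem apply_add (f : BimodHom K M N) (a b : M) : f (a + b) = f a + f b :=
  f.toLinearMap.map_add a b

theorem apply_smul (f : BimodHom K M N) (x : K) (a : M) : f (x • a) = x • f a :=
  f.toLinearMap.map_smul x a

theorem apply_rsmul (f : BimodHom K M N) (x : K) (a : M) : f (a <• x) = f a <• x :=
  f.map_rsmul x a

theorem apply_sum (f : BimodHom K M N) {ι : Type*} (s : Finset ι) (a : ι → M) :
    f (∑ i ∈ s, a i) = ∑ i ∈ s, f (a i) :=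
  map_sum f.toLinearMap a s

/-- The composite of two homomorphisms of bimodules. -/
def comp (g : BimodHom K N P) (f : BimodHom K M N) : BimodHom K M P where
  toLinearMap := g.toLinearMap ∘ₗ f.toLinearMap
  map_rsmul x m := (congrArg g (f.apply_rsmul x m)).trans (g.apply_rsmul x (f m))

theorem comp_apply (g : BimodHom K N P) (f : BimodHom K M N) (m : M) : g.comp f m = g (f m) := rfl

theorem id_apply (m : M) : BimodHom.id K M m = m := rfl

theorem exists_inverse (f : BimodHom K M N) (hf : Function.Bijective f.toFun) :
    ∃ g : BimodHom K N M, (∀ m, g (f m) = m) ∧ ∀ n, f (g n) = n := by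
  let e := LinearEquiv.ofBijective f.toLinearMap hf
  have h1 : ∀ m, e.symm (f m) = m := fun m => e.symm_apply_apply m
  have h2 : ∀ n, f (e.symm n) = n := fun n => e.apply_symm_apply n
  refine ⟨⟨e.symm.toLinearMap, fun x n => ?_⟩, h1, h2⟩
  change e.symm (n <• x) = e.symm n <• x
  rw [← h1 (e.symm n <• x), f.apply_rsmul, h2]

end BimodHom

namespace BiTensor

section
variable {M N : Type*} [AddCommGroup M] [Module Kᵐᵒᵖ M] [AddCommGroup N] [Module K N]

theorem tmul_sum (m : M) {ι : Type*} (s : Finset ι) (n : ι → N) :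
    tmul K m (∑ i ∈ s, n i) = ∑ i ∈ s, tmul K m (n i) :=
  map_sum (tmulHom K M N m) n s

theorem sum_tmul {ι : Type*} (s : Finset ι) (m : ι → M) (n : N) :
    tmul K (∑ i ∈ s, m i) n = ∑ i ∈ s, tmul K (m i) n :=
  map_sum ((tmulHom K M N).flip n) m s

theorem hom_ext {A : Type*} [AddCommGroup A] {f g : BiTensor K M N →+ A}
    (h : ∀ m n, f (tmul K m n) = g (tmul K m n)) : f = g := by
  ext z
  induction z using induction_on with
  | zero => simp only [map_zero]
  | tmul m n => exact h m n
  | add a b ha hb => simp only [map_add, ha, hb]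

theorem exists_eq_sum (z : BiTensor K M N) :
    ∃ (r : ℕ) (a : Fin r → M) (b : Fin r → N), z = ∑ i, tmul K (a i) (b i) := by
  induction z using induction_on with
  | zero => exact ⟨0, Fin.elim0, Fin.elim0, by simp⟩
  | tmul m n => exact ⟨1, fun _ => m, fun _ => n, by simp⟩
  | add a b ha hb =>
    obtain ⟨r, a₁, a₂, rfl⟩ := ha
    obtain ⟨s, b₁, b₂, rfl⟩ := hb
    exact ⟨r + s, Fin.append a₁ b₁, Fin.append a₂ b₂, by simp [Fin.sum_univ_add]⟩

end

section
variable {M N M' N' M'' N'' : Type*}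
  [AddCommGroup M] [Module K M] [Module Kᵐᵒᵖ M] [AddCommGroup N] [Module K N] [Module Kᵐᵒᵖ N]
  [AddCommGroup M'] [Module K M'] [Module Kᵐᵒᵖ M'] [AddCommGroup N'] [Module K N']
  [Module Kᵐᵒᵖ N'] [AddCommGroup M''] [Module K M''] [Module Kᵐᵒᵖ M''] [AddCommGroup N'']
  [Module K N''] [Module Kᵐᵒᵖ N'']

theorem map_tmul (f : BimodHom K M M') (g : BimodHom K N N') (m : M) (n : N) :
    map f g (tmul K m n) = tmul K (f m) (g n) := rfl

theorem map_sum_tmul (f : BimodHom K M M') (g : BimodHom K N N') {ι : Type*} (s : Finset ι)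
    (a : ι → M) (b : ι → N) :
    map f g (∑ i ∈ s, tmul K (a i) (b i)) = ∑ i ∈ s, tmul K (f (a i)) (g (b i)) := by
  rw [map_sum]; rfl

theorem map_map (f' : BimodHom K M' M'') (g' : BimodHom K N' N'') (f : BimodHom K M M')
    (g : BimodHom K N N') (z : BiTensor K M N) :
    map f' g' (map f g z) = map (f'.comp f) (g'.comp g) z :=
  DFunLike.congr_fun (hom_ext (f := (map f' g').comp (map f g))
    (g := map (f'.comp f) (g'.comp g)) fun _ _ => rfl) z

theorem map_id (z : BiTensor K M N) : map (BimodHom.id K M) (BimodHom.id K N) z = z :=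
  DFunLike.congr_fun (hom_ext (f := map (BimodHom.id K M) (BimodHom.id K N))
    (g := AddMonoidHom.id _) fun _ _ => rfl) z

end

theorem tmul_rsmul {M N : Type*} [AddCommGroup M] [Module Kᵐᵒᵖ M]
    [AddCommGroup N] [Module K N] [Module Kᵐᵒᵖ N] [SMulCommClass K Kᵐᵒᵖ N] (x : K) (m : M) (n : N) :
    tmul K m n <• x = tmul K m (n <• x) := rfl

section
variable {M N : Type*} [AddCommGroup M] [Module K M] [Module Kᵐᵒᵖ M] [SMulCommClass K Kᵐᵒᵖ M]
  [AddCommGroup N] [Module K N]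

theorem smul_tmul (x : K) (m : M) (n : N) : x • tmul K m n = tmul K (x • m) n := rfl

/-- The contraction `m ⊗ n ↦ m <• φ n` with a left linear functional `φ`. -/
def slice (φ : N →ₗ[K] K) : BiTensor K M N →ₗ[K] M where
  toFun := lift (AddMonoidHom.mk' (fun m => AddMonoidHom.mk' (fun n => m <• φ n)
        (fun n n' => by rw [map_add, MulOpposite.op_add, add_smul]))
      (fun m m' => by ext n; exact smul_add (MulOpposite.op (φ n)) m m'))
    (fun m x n => by
      change (m <• x) <• φ n = m <• φ (x • n)
      rw [map_smul, smul_eq_mul, MulOpposite.op_mul, mul_smul])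
  map_add' := map_add _
  map_smul' x z := by
    induction z using induction_on with
    | zero => simp only [smul_zero, map_zero]
    | tmul m n => exact (smul_comm x (MulOpposite.op (φ n)) m).symm
    | add a b ha hb => simp only [smul_add, map_add, ha, hb]

theorem slice_tmul (φ : N →ₗ[K] K) (m : M) (n : N) : slice φ (tmul K m n) = m <• φ n := rfl

theorem slice_sum_tmul (φ : N →ₗ[K] K) {ι : Type*} (s : Finset ι) (a : ι → M) (b : ι → N) :
    slice φ (∑ i ∈ s, tmul K (a i) (b i)) = ∑ i ∈ s, a i <• φ (b i) := by
  rw [map_sum]; rfl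

open Classical in
/-- Over a field, contraction against a family of functionals separating the points of `N`
separates the points of `M ⊗_K N`: expand along a basis of `M` for its right action. -/
theorem eq_of_slice_eq {ι : Type*} (φ : ι → N →ₗ[K] K)
    (hφ : ∀ n n' : N, (∀ i, φ i n = φ i n') → n = n') {z z' : BiTensor K M N}
    (h : ∀ i, slice (φ i) z = slice (φ i) z') : z = z' := by
  let b := Module.Basis.ofVectorSpace K (RightMod K M)
  let e : BiTensor K M N →+ _ →₀ N :=
    (TensorProduct.equivFinsuppOfBasisLeft (N := N) b).toLinearMap.toAddMonoidHom
  have he : ∀ m n j, e (tmul K m n) j = b.repr (RightMod.of K M m) j • n := fun m n j =>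
    TensorProduct.equivFinsuppOfBasisLeft_apply_tmul_apply b (RightMod.of K M m) n j
  have key : ∀ (ψ : N →ₗ[K] K) (z : BiTensor K M N) (j),
      b.repr (RightMod.of K M (slice ψ z)) j = ψ (e z j) := by
    intro ψ z j
    induction z using induction_on with
    | zero => simp only [map_zero, Finsupp.zero_apply]
    | tmul m n =>
      rw [slice_tmul, ← RightMod.smul_of, map_smul, Finsupp.smul_apply, he, map_smul,
        smul_eq_mul, smul_eq_mul, mul_comm]
    | add x y hx hy => simp only [map_add, Finsupp.add_apply, hx, hy]
  refine (TensorProduct.equivFinsuppOfBasisLeft (N := N) b).injective (Finsupp.ext fun j => ?_)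
  exact hφ _ _ fun i => (key (φ i) z j).symm.trans
    ((congrArg (fun m => b.repr (RightMod.of K M m) j) (h i)).trans (key (φ i) z' j))

end

end BiTensor

end Bimodules

/-! ### Derivations of the ring of Hurwitz series -/

section Hurwitz

variable {K : Type u} [Field K]

namespace Hurwitz

theorem shift_iterate_coeff (α : Hurwitz K) (m n : ℕ) :
    (shift^[m] α).coeff n = α.coeff (n + m) := by
  induction m generalizing α with
  | zero => rfl
  | succ m ih => rw [Function.iterate_succ_apply, ih, shift_coeff, add_assoc]

theorem shift_iterate_mul (α β : Hurwitz K) (m : ℕ) : shift^[m] (α * β) =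
    ∑ k ∈ Finset.range (m + 1), m.choose k • (shift^[k] α * shift^[m - k] β) := by
  induction m with
  | zero => simp
  | succ m ih =>
    rw [Finset.sum_choose_succ_nsmul (fun i j => shift^[i] α * shift^[j] β) m,
      Function.iterate_succ_apply', ih, map_sum, ← Finset.sum_add_distrib]
    refine Finset.sum_congr rfl fun k hk => ?_
    rw [map_nsmul, shift_mul, nsmul_add, ← Function.iterate_succ_apply' shift,
      ← Function.iterate_succ_apply' shift, Nat.succ_sub (Finset.mem_range_succ_iff.mp hk),
      add_comm]

theorem smul_one_eq (x : K) : x • (1 : Hurwitz K) = source x := by rw [smul_eq, mul_one]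

theorem shift_mul_coeff (α β : Hurwitz K) (n : ℕ) : (α * β).coeff (n + 1) =
    (shift α * β).coeff n + (α * shift β).coeff n := by
  rw [← shift_coeff, shift_mul, add_coeff]

theorem sum_coeff {ι : Type*} (s : Finset ι) (α : ι → Hurwitz K) (n : ℕ) :
    (∑ i ∈ s, α i).coeff n = ∑ i ∈ s, (α i).coeff n :=
  map_sum (AddMonoidHom.mk' (fun α : Hurwitz K => α.coeff n) fun _ _ => rfl) α s

variable [Differential K]

/-- The derivation `α ↦ (∂ (α n) - α (n + 1))ₙ`, the termwise derivation minus the shift. It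
vanishes on targets and restricts to `∂` on sources, whereas the shift vanishes on sources and
restricts to `∂` on targets; the antipode exchanges the two. -/
def coshift : Hurwitz K →+ Hurwitz K :=
  AddMonoidHom.mk' (fun α => ⟨fun n => (α.coeff n)′ - α.coeff (n + 1)⟩) (fun α β => by
    ext n
    simp only [add_coeff, map_add]
    ring)

theorem coshift_coeff (α : Hurwitz K) (n : ℕ) :
    (coshift α).coeff n = (α.coeff n)′ - α.coeff (n + 1) := rfl

theorem shift_coshift (α : Hurwitz K) : shift (coshift α) = coshift (shift α) := rfl

theorem coshift_mul (α β : Hurwitz K) : coshift (α * β) = coshift α * β + α * coshift β := by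
  have : ∀ n, ∀ α β : Hurwitz K,
      (coshift (α * β)).coeff n = (coshift α * β).coeff n + (α * coshift β).coeff n := by
    intro n
    induction n with
    | zero =>
      intro α β
      simp only [coshift_coeff, shift_mul_coeff, mul_coeff_zero, shift_coeff, Derivation.leibniz,
        smul_eq_mul]
      ring
    | succ n ih =>
      intro α β
      rw [← shift_coeff, shift_coshift, shift_mul, map_add, add_coeff, ih, ih, shift_mul_coeff,
        shift_mul_coeff, shift_coshift, shift_coshift]
      ring
  exact Hurwitz.ext (funext fun n => this n α β)

theorem coshift_source (x : K) : coshift (source x) = source x′ := by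
  ext n
  cases n with
  | zero => exact sub_zero _
  | succ n => exact (sub_zero _).trans (map_zero (Differential.deriv (R := K)))

theorem coshift_target (x : K) : coshift (target x) = 0 := by
  ext n
  rw [coshift_coeff, target_coeff, target_coeff, Function.iterate_succ_apply', sub_self]
  rfl

/-- The antipode of the Hurwitz series: its `n`-th term is the zeroth term of the `n`-th iterate
of `coshift`. -/
def antipode : Hurwitz K →+ Hurwitz K :=
  AddMonoidHom.mk' (fun α => ⟨fun n => (coshift^[n] α).coeff 0⟩) (fun α β => by
    ext n
    simp only [iterate_map_add, add_coeff])

theorem antipode_coeff_zero (α : Hurwitz K) : (antipode α).coeff 0 = α.coeff 0 := rfl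

theorem shift_antipode (α : Hurwitz K) : shift (antipode α) = antipode (coshift α) := rfl

theorem antipode_coeff (α : Hurwitz K) (n : ℕ) : (antipode α).coeff n =
    ∑ k ∈ Finset.range (n + 1), (n.choose k : K) * ((-1) ^ (n - k) *
      (Differential.deriv (R := K))^[k] (α.coeff (n - k))) := by
  induction n generalizing α with
  | zero => simp [antipode_coeff_zero]
  | succ n ih =>
    rw [← shift_coeff, shift_antipode, ih, Finset.sum_choose_succ_mul
      (fun i j => (-1) ^ j * (Differential.deriv (R := K))^[i] (α.coeff j)) n,
      ← Finset.sum_add_distrib]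
    refine Finset.sum_congr rfl fun k hk => ?_
    rw [coshift_coeff, iterate_map_sub, ← Function.iterate_succ_apply,
      Nat.succ_sub (Finset.mem_range_succ_iff.mp hk), Nat.succ_eq_add_one, Nat.succ_eq_add_one,
      pow_succ]
    ring

theorem antipode_mul (α β : Hurwitz K) : antipode (α * β) = antipode α * antipode β := by
  have : ∀ n, ∀ α β : Hurwitz K,
      (antipode (α * β)).coeff n = (antipode α * antipode β).coeff n := by
    intro n
    induction n with
    | zero => intro α β; simp only [antipode_coeff_zero, mul_coeff_zero]
    | succ n ih =>
      intro α β
      rw [← shift_coeff, shift_antipode, coshift_mul, map_add, add_coeff, ih, ih, shift_mul_coeff,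
        shift_antipode, shift_antipode]
  exact Hurwitz.ext (funext fun n => this n α β)

theorem antipode_source (x : K) : antipode (source x) = target x := by
  ext n
  induction n generalizing x with
  | zero => rfl
  | succ n ih => rw [← shift_coeff, shift_antipode, coshift_source, ih]; rfl

theorem antipode_target (x : K) : antipode (target x) = source x := by
  ext n
  cases n with
  | zero => rfl
  | succ n => rw [← shift_coeff, shift_antipode, coshift_target, map_zero]; rfl

theorem coshift_antipode (α : Hurwitz K) : coshift (antipode α) = antipode (shift α) := by
  ext n
  induction n generalizing α with
  | zero =>
    rw [coshift_coeff, ← shift_coeff, shift_antipode, antipode_coeff_zero, antipode_coeff_zero,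
      antipode_coeff_zero, coshift_coeff, shift_coeff, sub_sub_cancel]
  | succ n ih =>
    rw [← shift_coeff, ← shift_coeff, shift_coshift, shift_antipode, ih, shift_antipode,
      shift_coshift]

theorem antipode_antipode (α : Hurwitz K) : antipode (antipode α) = α := by
  ext n
  induction n generalizing α with
  | zero => rfl
  | succ n ih => rw [← shift_coeff, shift_antipode, coshift_antipode, ih]; rfl

end Hurwitz

end Hurwitz

/-! ### Matrix coefficients of differential vector spaces -/

section Coefficients

open Hurwitz

variable {K : Type u} [Field K] [Differential K]

namespace DiffMod

/-- The matrix coefficient `(φ (∂ⁿ m))ₙ` of a differential vector space `M`. -/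
def coeffSeq (M : DiffMod K) (φ : Module.Dual K M) (m : M) : Hurwitz K := ⟨fun n => φ (M.der^[n] m)⟩

variable (M : DiffMod K)

theorem coeffSeq_coeff_zero (φ : Module.Dual K M) (m : M) : (M.coeffSeq φ m).coeff 0 = φ m := rfl

theorem shift_coeffSeq (φ : Module.Dual K M) (m : M) :
    shift (M.coeffSeq φ m) = M.coeffSeq φ (M.der m) := rfl

theorem shift_iterate_coeffSeq (φ : Module.Dual K M) (m : M) (n : ℕ) :
    shift^[n] (M.coeffSeq φ m) = M.coeffSeq φ (M.der^[n] m) := by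
  induction n generalizing m with
  | zero => rfl
  | succ n ih => rw [Function.iterate_succ_apply, shift_coeffSeq, ih]; rfl

theorem coeffSeq_add_right (φ : Module.Dual K M) (m n : M) :
    M.coeffSeq φ (m + n) = M.coeffSeq φ m + M.coeffSeq φ n := by
  ext k
  exact (congrArg φ (iterate_map_add M.der k m n)).trans (map_add φ _ _)

theorem coeffSeq_add_left (φ ψ : Module.Dual K M) (m : M) :
    M.coeffSeq (φ + ψ) m = M.coeffSeq φ m + M.coeffSeq ψ m := rfl

theorem coeffSeq_smul_right (x : K) (φ : Module.Dual K M) (m : M) :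
    M.coeffSeq φ (x • m) = M.coeffSeq φ m <• x := by
  ext n
  induction n generalizing x m with
  | zero =>
    rw [Hurwitz.rsmul_eq, mul_coeff_zero, coeffSeq_coeff_zero, coeffSeq_coeff_zero, map_smul,
      smul_eq_mul, mul_comm]
    rfl
  | succ n ih =>
    rw [← shift_coeff, ← shift_coeff, shift_coeffSeq, leibniz, coeffSeq_add_right, add_coeff, ih,
      ih, shift_rsmul, add_coeff]
    rfl

theorem coeffSeq_sum_right (φ : Module.Dual K M) {ι : Type*} (s : Finset ι) (m : ι → M) :
    M.coeffSeq φ (∑ i ∈ s, m i) = ∑ i ∈ s, M.coeffSeq φ (m i) :=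
  map_sum (AddMonoidHom.mk' (M.coeffSeq φ) (M.coeffSeq_add_right φ)) m s

theorem coeffSeq_basis {ι : Type*} [Fintype ι] (e : Module.Basis ι K M) (φ : Module.Dual K M)
    (m : M) : M.coeffSeq φ m = ∑ i, M.coeffSeq φ (e i) <• e.coord i m := by
  conv_lhs => rw [← e.sum_repr m, coeffSeq_sum_right]
  exact Finset.sum_congr rfl fun i _ => M.coeffSeq_smul_right _ _ _

theorem coeffSeq_hom {M N : DiffMod K} (f : Hom M N) (ψ : Module.Dual K N) (m : M) :
    N.coeffSeq ψ (f.toLin m) = M.coeffSeq (ψ ∘ₗ f.toLin) m := by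
  ext n
  induction n generalizing m with
  | zero => rfl
  | succ n ih => rw [← shift_coeff, shift_coeffSeq, ← f.comm, ih]; rfl

/-- Products of matrix coefficients are matrix coefficients of the tensor product. -/
theorem coeffSeq_mul {P Q : DiffMod K} (φ : Module.Dual K P) (p : P) (ψ : Module.Dual K Q)
    (q : Q) : P.coeffSeq φ p * Q.coeffSeq ψ q =
      (Q.tensor P).coeffSeq (diamond ψ φ) (q ⊗ₜ[K] p : Q ⊗[K] P) := by
  ext n
  induction n generalizing p q with
  | zero => rw [mul_coeff_zero]; exact mul_comm _ _
  | succ n ih =>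
    have h : (Q.tensor P).der (q ⊗ₜ[K] p : Q ⊗[K] P) =
        ((Q.der q ⊗ₜ[K] p : Q ⊗[K] P) : Q.tensor P) + (q ⊗ₜ[K] P.der p : Q ⊗[K] P) :=
      tensorDer_tmul Q P q p
    rw [shift_mul_coeff, shift_coeffSeq, shift_coeffSeq, ih, ih, add_comm]
    exact congrArg (fun α : Hurwitz K => α.coeff n)
      ((congrArg ((Q.tensor P).coeffSeq (diamond ψ φ)) h).trans
        ((Q.tensor P).coeffSeq_add_right _ _ _)).symm

theorem coshift_coeffSeq (φ : Module.Dual K M) (m : M) :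
    coshift (M.coeffSeq φ m) = M.coeffSeq (M.dual.der φ) m := by
  ext n
  rw [coshift_coeff]
  exact congrArg (fun z => (φ (M.der^[n] m))′ - φ z) (Function.iterate_succ_apply' _ _ _)

/-- The antipode of a matrix coefficient is a matrix coefficient of the dual. -/
theorem antipode_coeffSeq (φ : Module.Dual K M) (m : M) :
    antipode (M.coeffSeq φ m) = M.dual.coeffSeq (Module.Dual.eval K M m) φ := by
  ext n
  induction n generalizing φ with
  | zero => rfl
  | succ n ih => rw [← shift_coeff, shift_antipode, coshift_coeffSeq]; exact ih _

theorem isDiffRecursive_coeffSeq (φ : Module.Dual K M) (m : M) :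
    IsDiffRecursive (M.coeffSeq φ m) := by
  let e := Module.finBasis K M
  let W := Submodule.span Kᵐᵒᵖ (Set.range fun i => M.coeffSeq φ (e i))
  have hW : ∀ m, M.coeffSeq φ m ∈ W := fun m => by
    rw [coeffSeq_basis M e]
    exact W.sum_mem fun i _ => W.smul_mem _ (Submodule.subset_span ⟨i, rfl⟩)
  refine (isDiffRecursive_iff _).mpr
    ⟨W, Module.Finite.span_of_finite _ (Set.finite_range _), fun β hβ => ?_, hW m⟩
  induction hβ using Submodule.span_induction with
  | mem x hx => obtain ⟨i, rfl⟩ := hx; exact hW _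
  | zero => rw [map_zero]; exact W.zero_mem
  | add x y _ _ hx hy => rw [map_add]; exact W.add_mem hx hy
  | smul a x hx ih =>
    change shift (x <• a.unop) ∈ W
    rw [shift_rsmul]
    exact W.add_mem (W.smul_mem _ ih) (W.smul_mem _ hx)

end DiffMod

end Coefficients

/-! ### Companion differential vector spaces -/

section Companion

open Hurwitz

variable {K : Type u} [Field K] [Differential K]

/-- The image of the `i`-th basis vector under the derivation of the companion space: the next
basis vector, or `∑ e_i c_i` for the last one. -/
def companionNext {d : ℕ} (c : Fin d → K) (i : Fin d) : Fin d → K :=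
  if h : (i : ℕ) + 1 < d then Pi.single ⟨i + 1, h⟩ 1 else c

/-- The companion differential vector space of `P = Y^d - ∑_{i<d} Y^i c_i`. It is `U / P U` in the
basis of the classes of `Y^i`, `i < d`, the derivation being right multiplication by `Y`. -/
def DiffMod.companion {d : ℕ} (c : Fin d → K) : DiffMod K where
  carrier := Fin d → K
  der := AddMonoidHom.mk' (fun v => (fun j => (v j)′) + ∑ i, v i • companionNext c i)
    (fun v w => by
      simp only [Pi.add_apply, map_add, add_smul, Finset.sum_add_distrib]
      rw [show (fun j => (v j)′ + (w j)′) = (fun j => (v j)′) + fun j => (w j)′ from rfl]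
      abel)
  leibniz x v := by
    change (fun j => (x * v j)′) + ∑ i, (x * v i) • companionNext c i =
      x • ((fun j => (v j)′) + ∑ i, v i • companionNext c i) + x′ • v
    ext j
    simp only [Pi.add_apply, Pi.smul_apply, Finset.sum_apply, smul_eq_mul, Derivation.leibniz,
      mul_add, Finset.mul_sum, mul_assoc]
    ring

/-- The class of `1` in the companion space. -/
def DiffMod.companionGen {d : ℕ} (c : Fin d → K) : companion c :=
  fun i : Fin d => if (i : ℕ) = 0 then (1 : K) else 0

theorem DiffMod.companion_der {d : ℕ} (c : Fin d → K) (v : Fin d → K) :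
    (companion c).der v = ((fun j => (v j)′) + ∑ i, v i • companionNext c i : Fin d → K) := rfl

/-- Let `T` be a derivation of a right vector space `A`. If `T^d a = ∑ T^i a c_i` modulo a stable
subspace `R`, then the coefficients of `T^n a` on the `T^i a` are, modulo `R`, the coordinates of
the `n`-th derivative of the generator of the companion space. -/
theorem iterate_sub_companion_mem {A : Type*} [AddCommGroup A] [Module Kᵐᵒᵖ A] (T : A →+ A)
    (hT : ∀ (a : A) (x : K), T (a <• x) = T a <• x + a <• x′) (R : Submodule Kᵐᵒᵖ A)
    (hR : ∀ r ∈ R, T r ∈ R) (a : A) {d : ℕ} (c : Fin d → K)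
    (h : T^[d] a - ∑ i : Fin d, T^[i] a <• c i ∈ R) (n : ℕ) :
    T^[n] a - ∑ i : Fin d, T^[i] a <•
      (((DiffMod.companion c).der^[n] (DiffMod.companionGen c) : Fin d → K) i) ∈ R := by
  let L : (Fin d → K) →+ A := AddMonoidHom.mk' (fun v => ∑ i : Fin d, T^[i] a <• v i)
    (fun v w => by simp only [Pi.add_apply, MulOpposite.op_add, add_smul, Finset.sum_add_distrib])
  have hL : ∀ v, L v = ∑ i : Fin d, T^[i] a <• v i := fun v => rfl
  have hLs : ∀ (x : K) v, L (x • v) = L v <• x := fun x v => by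
    rw [hL, hL, Finset.smul_sum]
    refine Finset.sum_congr rfl fun i _ => ?_
    rw [Pi.smul_apply, smul_eq_mul, mul_comm, MulOpposite.op_mul, mul_smul]
  have hLd : T^[d] a - L c ∈ R := h
  have hnext : ∀ i : Fin d, T^[(i : ℕ) + 1] a - L (companionNext c i) ∈ R := by
    intro i
    rw [companionNext]
    split_ifs with hi
    · rw [hL, Finset.sum_eq_single (⟨i + 1, hi⟩ : Fin d)]
      · simp
      · intro j _ hj
        rw [Pi.single_eq_of_ne hj, MulOpposite.op_zero, zero_smul]
      · simp
    · rwa [show (i : ℕ) + 1 = d by omega]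
  have hder : ∀ v : Fin d → K, T (L v) - L ((DiffMod.companion c).der v) ∈ R := by
    intro v
    have h1 : T (L v) - L ((DiffMod.companion c).der v) =
        ∑ i : Fin d, (T^[(i : ℕ) + 1] a - L (companionNext c i)) <• v i := by
      rw [DiffMod.companion_der, map_add, map_sum, hL, map_sum]
      simp only [hT, hLs, Finset.sum_add_distrib, smul_sub, Finset.sum_sub_distrib,
        ← Function.iterate_succ_apply' T]
      rw [hL]
      abel
    rw [h1]
    exact R.sum_mem fun i _ => R.smul_mem _ (hnext i)
  change T^[n] a - L ((DiffMod.companion c).der^[n] (DiffMod.companionGen c)) ∈ R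
  induction n with
  | zero =>
    rcases Nat.eq_zero_or_pos d with h0 | h0
    · subst h0
      have e : ∀ v w : Fin 0 → K, v = w := fun v w => Subsingleton.elim v w
      rwa [e c ((DiffMod.companion c).der^[0] (DiffMod.companionGen c))] at hLd
    · have : L (DiffMod.companionGen c) = a := by
        refine (hL _).trans ?_
        rw [Finset.sum_eq_single (⟨0, h0⟩ : Fin d)]
        · simp [DiffMod.companionGen]
        · intro j _ hj
          have : (j : ℕ) ≠ 0 := fun h => hj (Fin.ext h)
          simp [DiffMod.companionGen, this]
        · simp
      change a - L (DiffMod.companionGen c) ∈ R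
      rw [this, sub_self]
      exact R.zero_mem
  | succ n ih =>
    rw [Function.iterate_succ_apply', Function.iterate_succ_apply']
    have h1 := R.add_mem (hR _ ih) (hder ((DiffMod.companion c).der^[n] (DiffMod.companionGen c)))
    rwa [map_sub, sub_add_sub_cancel] at h1

theorem shift_iterate_eq_sum_companion (α : Hurwitz K) {d : ℕ} (c : Fin d → K)
    (h : shift^[d] α = ∑ i : Fin d, target (c i) * shift^[i] α) (n : ℕ) :
    shift^[n] α = ∑ i : Fin d, shift^[i] α <•
      (((DiffMod.companion c).der^[n] (DiffMod.companionGen c) : Fin d → K) i) := by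
  have h1 := iterate_sub_companion_mem (K := K) (A := Hurwitz K) shift.toAddMonoidHom shift_rsmul
    ⊥ (fun r hr => by
      rw [Submodule.mem_bot] at hr
      rw [hr, map_zero]
      exact Submodule.zero_mem _) α c (by
      rw [Submodule.mem_bot, sub_eq_zero]
      exact h.trans (Finset.sum_congr rfl fun i _ => (mul_comm _ _).trans (rsmul_eq _ _).symm)) n
  exact sub_eq_zero.mp ((Submodule.mem_bot _).mp h1)

theorem Ore.exists_Y_pow_eq {d : ℕ} (c : Fin d → K) (n : ℕ) : ∃ q : Ore K,
    Ore.Y ^ n = ∑ i : Fin d, Ore.Y ^ (i : ℕ) *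
        Ore.tau (((DiffMod.companion c).der^[n] (DiffMod.companionGen c) : Fin d → K) i) +
      (Ore.Y ^ d - ∑ i : Fin d, Ore.Y ^ (i : ℕ) * Ore.tau (c i)) * q := by
  let P : Ore K := Ore.Y ^ d - ∑ i : Fin d, Ore.Y ^ (i : ℕ) * Ore.tau (c i)
  let R : Submodule Kᵐᵒᵖ (Ore K) := LinearMap.range
    ({ toFun := fun q => P * q
       map_add' := mul_add P
       map_smul' := fun x q => (mul_assoc P q (Ore.tau x.unop)).symm } : Ore K →ₗ[Kᵐᵒᵖ] Ore K)
  have hY : ∀ n, (AddMonoidHom.mulRight (Ore.Y : Ore K))^[n] 1 = Ore.Y ^ n := by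
    intro n
    induction n with
    | zero => rfl
    | succ n ih => rw [Function.iterate_succ_apply', ih, pow_succ]; rfl
  have h1 := iterate_sub_companion_mem (AddMonoidHom.mulRight (Ore.Y : Ore K))
    (fun u x => by
      change u * Ore.tau x * Ore.Y = u * Ore.Y * Ore.tau x + u * Ore.tau x′
      rw [mul_assoc, Ore.tau_mul_Y, mul_add, mul_assoc])
    R (by
      rintro _ ⟨q, rfl⟩
      exact ⟨q * Ore.Y, (mul_assoc P q Ore.Y).symm⟩)
    1 c ⟨1, by
      simp only [hY]
      exact mul_one P⟩ n
  obtain ⟨q, hq⟩ := h1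
  refine ⟨q, ?_⟩
  simp only [hY] at hq
  exact (eq_add_of_sub_eq' hq.symm)

theorem Hurwitz.IsDiffRecursive.exists_shift_iterate_eq {α : Hurwitz K} (hα : IsDiffRecursive α) :
    ∃ (d : ℕ) (c : Fin d → K), shift^[d] α = ∑ i : Fin d, target (c i) * shift^[i] α := by
  obtain ⟨d, c, hc, h⟩ := hα
  refine ⟨d, fun i => -(c i / c d), ?_⟩
  rw [Finset.sum_range_succ, ← Fin.sum_univ_eq_sum_range (fun i => target (c i) * shift^[i] α)] at h
  have h2 := congrArg (target (c d)⁻¹ * ·) h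
  simp only [mul_zero, mul_add, Finset.mul_sum, ← mul_assoc, ← map_mul, inv_mul_cancel₀ hc,
    map_one, one_mul] at h2
  rw [eq_neg_of_add_eq_zero_right h2, ← Finset.sum_neg_distrib]
  refine Finset.sum_congr rfl fun i _ => ?_
  rw [map_neg, neg_mul, div_eq_inv_mul]

/-- Every differentially recursive sequence is a matrix coefficient of a companion space. -/
theorem Hurwitz.IsDiffRecursive.exists_coeffSeq {α : Hurwitz K} (hα : IsDiffRecursive α) :
    ∃ (M : DiffMod K) (φ : Module.Dual K M) (m : M), α = M.coeffSeq φ m := by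
  obtain ⟨d, c, h⟩ := hα.exists_shift_iterate_eq
  let φ : Module.Dual K (Fin d → K) := ∑ i : Fin d, α.coeff i • LinearMap.proj i
  have hφ : ∀ v, φ v = ∑ i : Fin d, α.coeff i * v i := fun v => by
    simp [φ]
  refine ⟨DiffMod.companion c, φ, DiffMod.companionGen c, Hurwitz.ext (funext fun n => ?_)⟩
  have h1 := congrArg (fun β : Hurwitz K => β.coeff 0) (shift_iterate_eq_sum_companion α c h n)
  simp only [sum_coeff, rsmul_eq, mul_coeff_zero, shift_iterate_coeff, zero_add] at h1
  exact h1.trans (hφ _).symm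

end Companion

/-! ### The Hopf algebroid of differentially recursive sequences -/

section DlinHopf

open Hurwitz

variable {K : Type u} [Field K] [Differential K]

theorem DiffMod.sum_antipode_coeffSeq_mul (M : DiffMod K) {ι : Type*} [Fintype ι]
    (e : Module.Basis ι K M) (φ : Module.Dual K M) (m : M) :
    ∑ i, antipode (M.coeffSeq φ (e i)) * M.coeffSeq (e.coord i) m = target (φ m) := by
  ext n
  induction n generalizing φ m with
  | zero =>
    simp only [sum_coeff, mul_coeff_zero, antipode_coeff_zero, coeffSeq_coeff_zero, target_coeff,
      Function.iterate_zero, id]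
    conv_rhs => rw [← e.sum_repr m, map_sum]
    refine Finset.sum_congr rfl fun i _ => ?_
    rw [map_smul, smul_eq_mul, mul_comm]
    rfl
  | succ n ih =>
    have h1 := ih (M.dual.der φ) m
    have h2 := ih φ (M.der m)
    rw [sum_coeff] at h1 h2 ⊢
    simp only [shift_mul_coeff, shift_antipode, coshift_coeffSeq, shift_coeffSeq,
      Finset.sum_add_distrib]
    rw [← shift_coeff, shift_target]
    refine (congrArg₂ (· + ·) h1 h2).trans ?_
    rw [← add_coeff, ← map_add]
    congr 2
    exact sub_add_cancel (φ m)′ (φ (M.der m))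

/-- If `∑ a₁ ⊗ a₂` and `∑ b₁ ⊗ b₂` have the contractions prescribed for the comultiplications of
`α` and `β`, then so does `∑ a₁ b₁ ⊗ a₂ b₂` for `α β`: this is the Leibniz rule. -/
theorem Hurwitz.sum_mul_target_mul {r s : ℕ} {α β : Hurwitz K} (a₁ a₂ : Fin r → Hurwitz K)
    (b₁ b₂ : Fin s → Hurwitz K) (ha : ∀ n, ∑ i, a₁ i * target ((a₂ i).coeff n) = shift^[n] α)
    (hb : ∀ n, ∑ j, b₁ j * target ((b₂ j).coeff n) = shift^[n] β) (n : ℕ) :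
    ∑ i, ∑ j, (a₁ i * b₁ j) * target ((a₂ i * b₂ j).coeff n) = shift^[n] (α * β) := by
  simp only [shift_iterate_mul, ← ha, ← hb, Finset.sum_mul_sum, Finset.smul_sum]
  refine Eq.trans ?_ Finset.sum_comm
  refine Finset.sum_congr rfl fun i _ => Eq.trans ?_ Finset.sum_comm
  refine Finset.sum_congr rfl fun j _ => ?_
  rw [mul_coeff, map_sum, Finset.mul_sum]
  refine Finset.sum_congr rfl fun k _ => ?_
  rw [nsmul_eq_mul, map_mul, map_natCast, map_mul]
  ring

namespace Dlin

/-- A matrix coefficient of a differential vector space, as an element of `Dlin K`. -/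
def matrixCoeff (M : DiffMod K) (φ : Module.Dual K M) (m : M) : Dlin K :=
  ⟨M.coeffSeq φ m, M.isDiffRecursive_coeffSeq φ m⟩

theorem coe_matrixCoeff (M : DiffMod K) (φ : Module.Dual K M) (m : M) :
    (matrixCoeff M φ m : Hurwitz K) = M.coeffSeq φ m := rfl

theorem exists_matrixCoeff (α : Dlin K) :
    ∃ (M : DiffMod K) (φ : Module.Dual K M) (m : M), α = matrixCoeff M φ m := by
  obtain ⟨M, φ, m, h⟩ := Hurwitz.IsDiffRecursive.exists_coeffSeq α.2
  exact ⟨M, φ, m, Subtype.ext h⟩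

/-- The `n`-th term of a sequence, a left linear functional on `Dlin K`. -/
def coeffHom (n : ℕ) : Dlin K →ₗ[K] K where
  toFun α := (α : Hurwitz K).coeff n
  map_add' _ _ := rfl
  map_smul' _ _ := rfl

theorem coeffHom_apply (n : ℕ) (α : Dlin K) : coeffHom n α = (α : Hurwitz K).coeff n := rfl

theorem ext_coeff {α β : Dlin K}
    (h : ∀ n, (α : Hurwitz K).coeff n = (β : Hurwitz K).coeff n) : α = β :=
  Subtype.ext (Hurwitz.ext (funext h))

theorem coe_sum {ι : Type*} (s : Finset ι) (α : ι → Dlin K) :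
    ((∑ i ∈ s, α i : Dlin K) : Hurwitz K) = ∑ i ∈ s, (α i : Hurwitz K) :=
  map_sum (Dlin K).subtype α s

theorem coe_rsmul_eq (α : Dlin K) (x : K) :
    ((α <• x : Dlin K) : Hurwitz K) = (α : Hurwitz K) * target x :=
  (coe_rsmul α _).trans (rsmul_eq _ _)

/-- The contraction `α ⊗ β ↦ α <• β n`. -/
def contract (n : ℕ) : BiTensor K (Dlin K) (Dlin K) →ₗ[K] Dlin K := BiTensor.slice (coeffHom n)

theorem contract_tmul (n : ℕ) (α β : Dlin K) :
    contract n (BiTensor.tmul K α β) = α <• (β : Hurwitz K).coeff n := rfl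

theorem tensor_ext {z z' : BiTensor K (Dlin K) (Dlin K)}
    (h : ∀ n, (contract n z : Hurwitz K) = contract n z') :
    z = z' :=
  BiTensor.eq_of_slice_eq coeffHom (fun _ _ h => ext_coeff h) fun n => Subtype.ext (h n)

theorem contract_sum_tmul {r : ℕ} (a b : Fin r → Dlin K) (n : ℕ) :
    (contract n (∑ i, BiTensor.tmul K (a i) (b i)) : Hurwitz K) =
      ∑ i, (a i : Hurwitz K) * target ((b i : Hurwitz K).coeff n) := by
  rw [contract, BiTensor.slice_sum_tmul, coe_sum]
  exact Finset.sum_congr rfl fun i _ => coe_rsmul_eq _ _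

theorem contract_sum_matrixCoeff (M : DiffMod K) (φ : Module.Dual K M) (m : M) {r : ℕ}
    (e : Module.Basis (Fin r) K M) (n : ℕ) :
    (contract n
      (∑ i, BiTensor.tmul K (matrixCoeff M φ (e i)) (matrixCoeff M (e.coord i) m)) : Hurwitz K) =
      shift^[n] (M.coeffSeq φ m) := by
  rw [contract_sum_tmul, M.shift_iterate_coeffSeq, M.coeffSeq_basis e]
  exact Finset.sum_congr rfl fun i _ => (rsmul_eq _ _).symm

theorem exists_comul (α : Dlin K) : ∃ z : BiTensor K (Dlin K) (Dlin K),
    ∀ n, (contract n z : Hurwitz K) = shift^[n] (α : Hurwitz K) := by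
  obtain ⟨M, φ, m, rfl⟩ := exists_matrixCoeff α
  exact ⟨_, contract_sum_matrixCoeff M φ m (Module.finBasis K M)⟩

/-- The comultiplication: `Δ α` is the only tensor whose contraction with the `n`-th term is the
`n`-th shift of `α`, for every `n`. -/
def comulFun (α : Dlin K) : BiTensor K (Dlin K) (Dlin K) := (exists_comul α).choose

theorem contract_comulFun (α : Dlin K) (n : ℕ) :
    (contract n (comulFun α) : Hurwitz K) = shift^[n] (α : Hurwitz K) :=
  (exists_comul α).choose_spec n

theorem comulFun_eq {α : Dlin K} {z : BiTensor K (Dlin K) (Dlin K)}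
    (h : ∀ n, (contract n z : Hurwitz K) = shift^[n] (α : Hurwitz K)) :
    comulFun α = z := tensor_ext fun n => (contract_comulFun α n).trans (h n).symm

theorem sum_mul_target_of_comulFun {α : Dlin K} {r : ℕ} {a b : Fin r → Dlin K}
    (h : comulFun α = ∑ i, BiTensor.tmul K (a i) (b i)) (n : ℕ) :
    ∑ i, (a i : Hurwitz K) * target ((b i : Hurwitz K).coeff n) = shift^[n] (α : Hurwitz K) := by
  rw [← contract_comulFun, h, contract_sum_tmul]

/-- The Hurwitz product of differentially recursive sequences. -/
def mul (α β : Dlin K) : Dlin K := ⟨(α : Hurwitz K) * β, by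
  obtain ⟨P, φ, p, rfl⟩ := exists_matrixCoeff α
  obtain ⟨Q, ψ, q, rfl⟩ := exists_matrixCoeff β
  rw [coe_matrixCoeff, coe_matrixCoeff, DiffMod.coeffSeq_mul]
  exact (Q.tensor P).isDiffRecursive_coeffSeq _ _⟩

theorem coe_mul (α β : Dlin K) : (mul α β : Hurwitz K) = α * β := rfl

/-- The target of `x`, as a differentially recursive sequence. -/
def targetElem (x : K) : Dlin K := matrixCoeff (DiffMod.unit K) LinearMap.id x

theorem coe_targetElem (x : K) : (targetElem x : Hurwitz K) = target x := rfl

/-- The antipode of `Dlin K`. -/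
def antipode (α : Dlin K) : Dlin K := ⟨Hurwitz.antipode α, by
  obtain ⟨M, φ, m, rfl⟩ := exists_matrixCoeff α
  rw [coe_matrixCoeff, DiffMod.antipode_coeffSeq]
  exact M.dual.isDiffRecursive_coeffSeq _ _⟩

theorem coe_antipode (α : Dlin K) : (antipode α : Hurwitz K) = Hurwitz.antipode α := rfl

theorem coe_targetElem_one : ((targetElem (1 : K) : Dlin K) : Hurwitz K) = 1 := map_one target

theorem comulFun_mul {α β : Dlin K} {r s : ℕ} {a₁ a₂ : Fin r → Dlin K} {b₁ b₂ : Fin s → Dlin K}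
    (ha : comulFun α = ∑ i, BiTensor.tmul K (a₁ i) (a₂ i))
    (hb : comulFun β = ∑ j, BiTensor.tmul K (b₁ j) (b₂ j)) :
    comulFun (mul α β) = ∑ i, ∑ j, BiTensor.tmul K (mul (a₁ i) (b₁ j)) (mul (a₂ i) (b₂ j)) :=
  comulFun_eq fun n => by
    rw [map_sum, coe_sum, coe_mul, ← sum_mul_target_mul _ _ _ _ (sum_mul_target_of_comulFun ha)
      (sum_mul_target_of_comulFun hb)]
    exact Finset.sum_congr rfl fun i _ => contract_sum_tmul _ _ n

theorem comulFun_targetElem (x : K) :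
    comulFun (targetElem x) = BiTensor.tmul K (targetElem 1) (targetElem x) :=
  comulFun_eq fun n => by
    rw [contract_tmul, coe_rsmul_eq, coe_targetElem_one, one_mul,
      coe_targetElem, target_coeff]
    induction n generalizing x with
    | zero => rfl
    | succ n ih => rw [Function.iterate_succ_apply, ih, Function.iterate_succ_apply, shift_target]

/-- The comultiplication as a homomorphism of bimodules. Compatibility with the right action is
the case of a target in `comulFun_mul`. -/
def comulHom : BimodHom K (Dlin K) (BiTensor K (Dlin K) (Dlin K)) where
  toFun := comulFun
  map_add' α β := comulFun_eq fun n => by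
    rw [map_add, Submodule.coe_add, contract_comulFun, contract_comulFun, Submodule.coe_add,
      iterate_map_add]
  map_smul' x α := comulFun_eq fun n => by
    rw [RingHom.id_apply, map_smul, Submodule.coe_smul, contract_comulFun, Submodule.coe_smul]
    induction n with
    | zero => rfl
    | succ n ih =>
      rw [Function.iterate_succ_apply', Function.iterate_succ_apply', ← map_smul, ih]
  map_rsmul x α := by
    obtain ⟨r, a, b, h⟩ := BiTensor.exists_eq_sum (comulFun α)
    have h1 : α <• x = mul α (targetElem x) := Subtype.ext (coe_rsmul_eq α x)
    have h2 : comulFun (targetElem x) =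
        ∑ _j : Fin 1, BiTensor.tmul K (targetElem 1) (targetElem x) := by
      rw [comulFun_targetElem, Finset.sum_const, Finset.card_univ, Fintype.card_fin, one_smul]
    rw [h1, comulFun_mul h h2, h, Finset.smul_sum]
    refine Finset.sum_congr rfl fun i _ => ?_
    rw [Finset.sum_const, Finset.card_univ, Fintype.card_fin, one_smul, BiTensor.tmul_rsmul]
    congr 1
    · exact Subtype.ext (by rw [coe_mul, coe_targetElem_one, mul_one])
    · exact Subtype.ext (coe_rsmul_eq (b i) x).symm

theorem comulHom_apply (α : Dlin K) : comulHom α = comulFun α := rfl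

/-- The counit `α ↦ α 0`. -/
def counitHom : BimodHom K (Dlin K) K where
  toLinearMap := coeffHom 0
  map_rsmul x α := (congrArg (fun β : Hurwitz K => β.coeff 0) (coe_rsmul_eq α x)).trans
    (mul_coeff_zero _ _)

theorem counitHom_apply (α : Dlin K) : counitHom α = (α : Hurwitz K).coeff 0 := rfl

theorem slice_assoc_tmul (z : BiTensor K (Dlin K) (Dlin K)) (b : Dlin K) (m n : ℕ) :
    BiTensor.slice (coeffHom n ∘ₗ contract m)
        (BiTensor.assoc _ _ _ (BiTensor.tmul K z b)) =
      contract n (z <• (b : Hurwitz K).coeff m) := by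
  obtain ⟨r, p, q, rfl⟩ := BiTensor.exists_eq_sum z
  rw [Finset.smul_sum, BiTensor.sum_tmul, map_sum, map_sum, map_sum]
  rfl

theorem comulHom_coassoc (α : Dlin K) :
    BiTensor.assoc _ _ _ (BiTensor.map comulHom (BimodHom.id K _) (comulHom α)) =
      BiTensor.map (BimodHom.id K _) comulHom (comulHom α) := by
  obtain ⟨r, a, b, h⟩ := BiTensor.exists_eq_sum (comulFun α)
  refine BiTensor.eq_of_slice_eq
    (fun p : ℕ × ℕ => coeffHom p.2 ∘ₗ contract p.1)
    (fun z z' hz => tensor_ext fun m => ?_) fun p => ?_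
  · exact Hurwitz.ext (funext fun n => hz (m, n))
  · have hs : contract p.1 (comulFun α) = ∑ i, a i <• coeffHom p.1 (b i) := by
      rw [h, contract, BiTensor.slice_sum_tmul]
    have hα := contract_comulFun α p.1
    rw [comulHom_apply, h, BiTensor.map_sum_tmul, BiTensor.map_sum_tmul, map_sum, map_sum,
      BiTensor.slice_sum_tmul]
    -- Both sides are the shift of `α` by the sum of the two indices.
    have h1 : ∑ i, BiTensor.slice (coeffHom p.2 ∘ₗ contract p.1)
        (BiTensor.assoc _ _ _ (BiTensor.tmul K (comulHom (a i)) (BimodHom.id K _ (b i)))) =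
        contract p.2 (comulFun (contract p.1 (comulFun α))) := by
      rw [hs, ← comulHom_apply, BimodHom.apply_sum, map_sum]
      refine Finset.sum_congr rfl fun i _ => ?_
      rw [BimodHom.id_apply, slice_assoc_tmul, ← BimodHom.apply_rsmul]
      rfl
    rw [h1]
    refine Subtype.ext ?_
    rw [contract_comulFun, hα, ← Function.iterate_add_apply, ← sum_mul_target_of_comulFun h, coe_sum]
    refine Finset.sum_congr rfl fun i _ => ?_
    rw [coe_rsmul_eq, BimodHom.id_apply, LinearMap.comp_apply, coeffHom_apply, comulHom_apply,
      contract_comulFun, shift_iterate_coeff]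

theorem counitHom_left (α : Dlin K) :
    BiTensor.leftUnitor _ (BiTensor.map counitHom (BimodHom.id K _) (comulHom α)) = α := by
  obtain ⟨r, a, b, h⟩ := BiTensor.exists_eq_sum (comulFun α)
  rw [comulHom_apply, h, BiTensor.map_sum_tmul, map_sum]
  refine ext_coeff fun n => ?_
  have h1 := congrArg (fun β : Hurwitz K => β.coeff 0) (sum_mul_target_of_comulFun h n)
  simp only [sum_coeff, mul_coeff_zero, shift_iterate_coeff, zero_add] at h1
  rw [← h1, coe_sum, sum_coeff]
  rfl

theorem counitHom_right (α : Dlin K) :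
    BiTensor.rightUnitor _ (BiTensor.map (BimodHom.id K _) counitHom (comulHom α)) = α := by
  obtain ⟨r, a, b, h⟩ := BiTensor.exists_eq_sum (comulFun α)
  rw [comulHom_apply, h, BiTensor.map_sum_tmul, map_sum]
  refine Subtype.ext ?_
  refine Eq.trans ?_ (sum_mul_target_of_comulFun h 0)
  rw [coe_sum]
  exact Finset.sum_congr rfl fun i _ => coe_rsmul_eq _ _

theorem smul_eq_rsmul_of_deriv_eq_zero {x : K} (hx : x′ = 0) (α : Dlin K) : x • α = α <• x := by
  refine Subtype.ext ?_
  have : target x = source x := by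
    ext n
    cases n with
    | zero => rfl
    | succ n => rw [← shift_coeff, shift_target, hx, map_zero]; rfl
  rw [coe_rsmul_eq, this, mul_comm]
  exact smul_eq x _

variable (K) in
/-- The coring of differentially recursive sequences. -/
def coring : Coring K (Dlin K) where
  central _ hx α := smul_eq_rsmul_of_deriv_eq_zero hx α
  comul := comulHom
  counit := counitHom
  coassoc := comulHom_coassoc
  counit_left := counitHom_left
  counit_right := counitHom_right

theorem coe_smul_one (x : K) : ((x • targetElem 1 : Dlin K) : Hurwitz K) = source x := by
  rw [Submodule.coe_smul, coe_targetElem_one, smul_one_eq]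

theorem coe_one_rsmul (x : K) : ((targetElem 1 <• x : Dlin K) : Hurwitz K) = target x := by
  rw [coe_rsmul_eq, coe_targetElem_one, one_mul]

theorem sum_antipode_mul {α : Dlin K} {r : ℕ} {a b : Fin r → Dlin K}
    (h : comulFun α = ∑ i, BiTensor.tmul K (a i) (b i)) :
    ∑ i, Hurwitz.antipode (a i : Hurwitz K) * (b i : Hurwitz K) =
      target ((α : Hurwitz K).coeff 0) := by
  -- `a ⊗ b ↦ S(a) b` is balanced, so one representative of `Δ α` may be used.
  let F : BiTensor K (Dlin K) (Dlin K) →+ Hurwitz K := BiTensor.lift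
    (((AddMonoidHom.mul (R := Hurwitz K)).comp
      (Hurwitz.antipode.comp (Dlin K).subtype.toAddMonoidHom)).compl₂
        (Dlin K).subtype.toAddMonoidHom)
    (fun m x n => by
      change Hurwitz.antipode ((m <• x : Dlin K) : Hurwitz K) * (n : Hurwitz K) =
        Hurwitz.antipode (m : Hurwitz K) * ((x • n : Dlin K) : Hurwitz K)
      rw [coe_rsmul_eq, Hurwitz.antipode_mul, Hurwitz.antipode_target, Submodule.coe_smul, smul_eq,
        mul_assoc])
  have hF : ∀ a b : Dlin K, F (BiTensor.tmul K a b) =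
    Hurwitz.antipode (a : Hurwitz K) * (b : Hurwitz K) := fun _ _ => rfl
  obtain ⟨M, φ, m, rfl⟩ := exists_matrixCoeff α
  have h1 := comulFun_eq (α := matrixCoeff M φ m)
    (contract_sum_matrixCoeff M φ m (Module.finBasis K M))
  have h2 := congrArg F (h.symm.trans h1)
  rw [map_sum, map_sum] at h2
  simp only [hF] at h2
  exact h2.trans (M.sum_antipode_coeffSeq_mul (Module.finBasis K M) φ m)

variable (K) in
/-- The Hopf algebroid of differentially recursive sequences. -/
def hopf : HopfAlgebroid K (Dlin K) where
  toCoring := coring K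
  mul := mul
  one := targetElem 1
  antipode := antipode
  add_mul a b c := Subtype.ext (add_mul (a : Hurwitz K) b c)
  mul_comm a b := Subtype.ext (mul_comm (a : Hurwitz K) b)
  mul_assoc a b c := Subtype.ext (mul_assoc (a : Hurwitz K) b c)
  one_mul a := Subtype.ext (by rw [coe_mul, coe_targetElem_one, one_mul])
  smul_mul x a b := Subtype.ext (by
    simp only [coe_mul, Submodule.coe_smul, smul_eq, mul_assoc])
  rsmul_mul x a b := Subtype.ext (by
    rw [coe_mul, coe_rsmul_eq, coe_rsmul_eq, coe_mul, mul_right_comm])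
  counit_one := rfl
  counit_mul a b := mul_coeff_zero _ _
  comul_one := comulFun_targetElem 1
  comul_mul a b m n a₁ a₂ b₁ b₂ ha hb := comulFun_mul ha hb
  antipode_add a b := Subtype.ext (map_add Hurwitz.antipode (a : Hurwitz K) b)
  antipode_mul a b := Subtype.ext (Hurwitz.antipode_mul (a : Hurwitz K) b)
  antipode_source x := Subtype.ext (by
    rw [coe_antipode, coe_smul_one, coe_one_rsmul, Hurwitz.antipode_source])
  antipode_target x := Subtype.ext (by
    rw [coe_antipode, coe_smul_one, coe_one_rsmul, Hurwitz.antipode_target])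
  antipode_antipode a := Subtype.ext (Hurwitz.antipode_antipode (a : Hurwitz K))
  antipode_left a m a₁ a₂ h := Subtype.ext (by
    rw [coe_sum, coe_one_rsmul]
    exact sum_antipode_mul h)
  -- The image of the other antipode identity under the antipode.
  antipode_right a m a₁ a₂ h := Subtype.ext (by
    rw [coe_sum, coe_smul_one]
    change _ = source ((a : Hurwitz K).coeff 0)
    rw [← Hurwitz.antipode_target, ← sum_antipode_mul h, map_sum]
    refine Finset.sum_congr rfl fun i _ => ?_
    rw [coe_mul, Hurwitz.antipode_mul, Hurwitz.antipode_antipode, coe_antipode])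

theorem hopf_comul_matrixCoeff (M : DiffMod K) (φ : Module.Dual K M) (m : M) {r : ℕ}
    (e : Module.Basis (Fin r) K M) : (hopf K).comul (matrixCoeff M φ m) =
      ∑ i, BiTensor.tmul K (matrixCoeff M φ (e i)) (matrixCoeff M (e.coord i) m) :=
  comulFun_eq (contract_sum_matrixCoeff M φ m e)

theorem shift_iterate_mem (α : Dlin K) (n : ℕ) : shift^[n] (α : Hurwitz K) ∈ Dlin K := by
  obtain ⟨M, φ, m, rfl⟩ := exists_matrixCoeff α
  rw [coe_matrixCoeff, M.shift_iterate_coeffSeq]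
  exact M.isDiffRecursive_coeffSeq _ _

theorem isDlinHopf_hopf : IsDlinHopf (hopf K) where
  one := coe_targetElem_one
  mul _ _ := rfl
  counit α := counitHom_apply α
  antipode α n := antipode_coeff (α : Hurwitz K) n
  comul α d c h := by
    refine ⟨fun i => ⟨_, shift_iterate_mem α i⟩,
      fun i => matrixCoeff (DiffMod.companion c) (LinearMap.proj (R := K) (φ := fun _ => K) i)
        (DiffMod.companionGen c), fun i => rfl, Ore.exists_Y_pow_eq c, comulFun_eq fun n => ?_⟩
    rw [contract_sum_tmul, shift_iterate_eq_sum_companion (α : Hurwitz K) c h]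
    exact Finset.sum_congr rfl fun i _ => (rsmul_eq _ _).symm

end Dlin

end DlinHopf

/-! ### Functionals on the ring of differential operators -/

section OreDual

open Hurwitz

variable {K : Type u} [Field K] [Differential K]

namespace Ore

theorem induction_on {p : Ore K → Prop} (u : Ore K) (add : ∀ u v, p u → p v → p (u + v))
    (Y_pow_mul_tau : ∀ n a, p (Y ^ n * tau a)) : p u := by
  obtain ⟨q⟩ := u
  induction q using Polynomial.induction_on' with
  | add q r hq hr => exact add _ _ hq hr
  | monomial n a =>
    have : (⟨Polynomial.monomial n a⟩ : Ore K) = Y ^ n * tau a := Ore.ext (by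
      rw [mul_tau_toPoly, Y_pow_toPoly, Polynomial.smul_X_eq_monomial])
    rw [this]
    exact Y_pow_mul_tau n a

namespace Dual

theorem apply_mul_tau (f : Dual K) (u : Ore K) (a : K) : f (u * tau a) = f u * a :=
  f.map_smul (MulOpposite.op a) u

theorem ext_Y_pow {f g : Dual K} (h : ∀ n : ℕ, f (Y ^ n) = g (Y ^ n)) : f = g := by
  refine LinearMap.ext fun u => ?_
  induction u using Ore.induction_on with
  | add u v hu hv => rw [map_add, map_add, hu, hv]
  | Y_pow_mul_tau n a => rw [apply_mul_tau, apply_mul_tau, h]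

/-- The sequence of values of a functional on the powers of `Y`. -/
def toSeq (f : Dual K) : Hurwitz K := ⟨fun n => f (Y ^ n)⟩

theorem ofSeq_toSeq (f : Dual K) : ofSeq (toSeq f) = f := ext_Y_pow fun n => ofSeq_Y_pow _ n

theorem toSeq_add (f g : Dual K) : toSeq (f + g) = toSeq f + toSeq g := rfl

theorem ofSeq_add (α β : Hurwitz K) : ofSeq (α + β) = ofSeq α + ofSeq β :=
  ext_Y_pow fun n => by
    rw [LinearMap.add_apply, ofSeq_Y_pow, ofSeq_Y_pow, ofSeq_Y_pow, add_coeff]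

theorem ofSeq_sum {ι : Type*} (s : Finset ι) (α : ι → Hurwitz K) (u : Ore K) :
    ofSeq (∑ i ∈ s, α i) u = ∑ i ∈ s, ofSeq (α i) u := by
  rw [← LinearMap.sum_apply]
  exact congrArg (· u) (map_sum (AddMonoidHom.mk' ofSeq ofSeq_add) α s)

theorem ofSeq_smul (x : K) (α : Hurwitz K) (u : Ore K) : ofSeq (x • α) u = x * ofSeq α u := by
  induction u using Ore.induction_on with
  | add u v hu hv => rw [map_add, map_add, hu, hv, mul_add]
  | Y_pow_mul_tau n a =>
    rw [apply_mul_tau, apply_mul_tau, ofSeq_Y_pow, ofSeq_Y_pow, smul_coeff, mul_assoc]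

theorem ofSeq_Y_pow_mul (α : Hurwitz K) (n : ℕ) (u : Ore K) :
    ofSeq α (Y ^ n * u) = ofSeq (shift^[n] α) u := by
  induction u using Ore.induction_on with
  | add u v hu hv => rw [mul_add, map_add, map_add, hu, hv]
  | Y_pow_mul_tau m a =>
    rw [← mul_assoc, ← pow_add, apply_mul_tau, apply_mul_tau, ofSeq_Y_pow, ofSeq_Y_pow,
      shift_iterate_coeff, add_comm]

/-- Left multiplication by `τ a` on `U` is dual to multiplication by the target of `a`. -/
theorem ofSeq_tau_mul (α : Hurwitz K) (a : K) (u : Ore K) :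
    ofSeq α (tau a * u) = ofSeq (α * target a) u := by
  have key : ∀ (n : ℕ) (α : Hurwitz K) (a : K),
      ofSeq α (tau a * Y ^ n) = (α * target a).coeff n := by
    intro n
    induction n with
    | zero =>
      intro α a
      rw [pow_zero, mul_one, ← one_mul (tau a), apply_mul_tau, ← pow_zero Y, ofSeq_Y_pow,
        mul_coeff_zero]
      rfl
    | succ n ih =>
      intro α a
      have h := ofSeq_Y_pow_mul α 1 (tau a * Y ^ n)
      rw [pow_one] at h
      rw [pow_succ', ← mul_assoc, tau_mul_Y, add_mul, map_add, mul_assoc, h, ih, ih,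
        shift_mul_coeff, shift_target]
      rfl
  induction u using Ore.induction_on with
  | add u v hu hv => rw [mul_add, map_add, map_add, hu, hv]
  | Y_pow_mul_tau m b =>
    rw [← mul_assoc, apply_mul_tau, apply_mul_tau, ofSeq_Y_pow, key]

end Dual

end Ore

end OreDual

/-! ### The universal property of differentially recursive sequences -/

section DlinSaft

open Hurwitz

variable {K : Type u} [Field K] [Differential K]

theorem Hurwitz.isDiffRecursive_of_shift_mem_span {r : ℕ} {α : Hurwitz K} (b : Fin r → Hurwitz K)
    (h : ∀ n, shift^[n] α ∈ Submodule.span Kᵐᵒᵖ (Set.range b)) : IsDiffRecursive α := by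
  let B := Submodule.span Kᵐᵒᵖ (Set.range b)
  let W := Submodule.span Kᵐᵒᵖ (Set.range fun n => shift^[n] α)
  have hB : Module.Finite Kᵐᵒᵖ B := Module.Finite.span_of_finite _ (Set.finite_range _)
  have hWB : W ≤ B := Submodule.span_le.mpr (by rintro _ ⟨n, rfl⟩; exact h n)
  refine (isDiffRecursive_iff _).mpr
    ⟨W, Module.Finite.of_injective _ (Submodule.inclusion_injective hWB), fun β hβ => ?_,
      Submodule.subset_span ⟨0, rfl⟩⟩
  induction hβ using Submodule.span_induction with
  | mem x hx =>
    obtain ⟨n, rfl⟩ := hx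
    exact Submodule.subset_span ⟨n + 1, Function.iterate_succ_apply' _ _ _⟩
  | zero => rw [map_zero]; exact W.zero_mem
  | add x y _ _ hx hy => rw [map_add]; exact W.add_mem hx hy
  | smul a x hx ih =>
    change shift (x <• a.unop) ∈ W
    rw [shift_rsmul]
    exact W.add_mem (W.smul_mem _ ih) (W.smul_mem _ hx)

namespace Dlin

theorem xi_apply (α : Dlin K) : xi α = Ore.Dual.ofSeq (α : Hurwitz K) := rfl

theorem xi_injective : Function.Injective (xi (K := K)) := fun α β h => ext_coeff fun n => by
  rw [← Ore.Dual.ofSeq_Y_pow, ← Ore.Dual.ofSeq_Y_pow, ← xi_apply, h, xi_apply]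

theorem respectsConv_hopf : RespectsConv (hopf K) xi where
  one := congrArg Ore.Dual.ofSeq coe_targetElem_one
  mul a b := by
    simp only [Ore.Dual.conv, xi_apply, Ore.Dual.ofSeq_Y_pow]
    rfl

theorem saftRel_coring : SaftRel (coring K) xi where
  one z := (Ore.Dual.ofSeq_Y_pow (z : Hurwitz K) 0)
  bilin x y z u := by
    rw [xi_apply, xi_apply, Ore.Dual.ofSeq_tau_mul, ← Ore.Dual.ofSeq_smul,
      ← coe_rsmul_eq]
    rfl
  mul z m z₁ z₂ h u v := by
    simp only [xi_apply]
    induction u using Ore.induction_on generalizing v with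
    | add u w hu hw =>
      simp only [add_mul, map_add, hu, hw, Finset.sum_add_distrib]
    | Y_pow_mul_tau n a =>
      rw [mul_assoc, Ore.Dual.ofSeq_Y_pow_mul, ← sum_mul_target_of_comulFun h, Ore.Dual.ofSeq_sum]
      refine Finset.sum_congr rfl fun i _ => ?_
      rw [Ore.Dual.apply_mul_tau, Ore.Dual.ofSeq_Y_pow, map_mul Ore.tau, mul_assoc,
        Ore.Dual.ofSeq_tau_mul (z₁ i : Hurwitz K)]

end Dlin

section Lift

variable {C : Type v} [AddCommGroup C] [Module K C] [Module Kᵐᵒᵖ C] [SMulCommClass K Kᵐᵒᵖ C]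
  {Λ : Coring K C} {f : C →+ Ore.Dual K}

namespace SaftRel

theorem toSeq_smul (hf : SaftRel Λ f) (x : K) (c : C) :
    Ore.Dual.toSeq (f (x • c)) = x • Ore.Dual.toSeq (f c) := by
  ext n
  have h := hf.bilin x 1 c (Ore.Y ^ n)
  rwa [MulOpposite.op_one, one_smul, map_one, one_mul] at h

theorem toSeq_rsmul (hf : SaftRel Λ f) (c : C) (y : K) :
    Ore.Dual.toSeq (f (c <• y)) = Ore.Dual.toSeq (f c) * target y := by
  ext n
  have h := hf.bilin 1 y c (Ore.Y ^ n)
  rw [one_smul, one_mul, ← Ore.Dual.ofSeq_toSeq (f c), Ore.Dual.ofSeq_tau_mul,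
    Ore.Dual.ofSeq_Y_pow] at h
  exact h

theorem shift_iterate_toSeq (hf : SaftRel Λ f) {c : C} {r : ℕ} {c₁ c₂ : Fin r → C}
    (h : Λ.comul c = ∑ i, BiTensor.tmul K (c₁ i) (c₂ i)) (n : ℕ) :
    shift^[n] (Ore.Dual.toSeq (f c)) =
      ∑ i, Ore.Dual.toSeq (f (c₁ i)) * target ((Ore.Dual.toSeq (f (c₂ i))).coeff n) := by
  ext m
  rw [shift_iterate_coeff, sum_coeff]
  change f c (Ore.Y ^ (m + n)) = _
  rw [add_comm, pow_add, hf.mul c r c₁ c₂ h]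
  refine Finset.sum_congr rfl fun i _ => ?_
  rw [← toSeq_rsmul hf]
  have h := hf.bilin 1 (f (c₂ i) (Ore.Y ^ n)) (c₁ i) (Ore.Y ^ m)
  rw [one_smul, one_mul] at h
  exact h.symm

/-- The shifts of the sequence of `c` lie in the right span of the sequences of the first tensor
factors of the comultiplication of `c`, which has finite dimension. -/
theorem isDiffRecursive_toSeq (hf : SaftRel Λ f) (c : C) :
    IsDiffRecursive (Ore.Dual.toSeq (f c)) := by
  obtain ⟨r, c₁, c₂, h⟩ := BiTensor.exists_eq_sum (Λ.comul c)
  refine isDiffRecursive_of_shift_mem_span (fun i => Ore.Dual.toSeq (f (c₁ i))) fun n => ?_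
  rw [shift_iterate_toSeq hf h]
  refine Submodule.sum_mem _ fun i _ => ?_
  rw [← Hurwitz.rsmul_eq]
  exact Submodule.smul_mem _ _ (Submodule.subset_span ⟨i, rfl⟩)

/-- The map to `Dlin K` induced by a map from a coring to `U*`. -/
def toDlin (hf : SaftRel Λ f) : BimodHom K C (Dlin K) where
  toFun c := ⟨Ore.Dual.toSeq (f c), hf.isDiffRecursive_toSeq c⟩
  map_add' a b := Subtype.ext ((congrArg Ore.Dual.toSeq (map_add f a b)).trans
    (Ore.Dual.toSeq_add _ _))
  map_smul' x c := Subtype.ext (hf.toSeq_smul x c)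
  map_rsmul x c := Subtype.ext ((hf.toSeq_rsmul c x).trans (Hurwitz.rsmul_eq _ _).symm)

theorem xi_toDlin (hf : SaftRel Λ f) (c : C) : Dlin.xi (hf.toDlin c) = f c :=
  Ore.Dual.ofSeq_toSeq (f c)

theorem isCoringHom_toDlin (hf : SaftRel Λ f) : IsCoringHom Λ (Dlin.coring K) hf.toDlin where
  comul c := by
    obtain ⟨r, c₁, c₂, h⟩ := BiTensor.exists_eq_sum (Λ.comul c)
    rw [h, BiTensor.map_sum_tmul]
    refine Dlin.comulFun_eq fun n => ?_
    rw [Dlin.contract_sum_tmul]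
    exact (hf.shift_iterate_toSeq h n).symm
  counit c := hf.one c

end SaftRel

end Lift

theorem Dlin.isSaftDual_coring : IsSaftDual.{u, v, u} (Dlin.coring K) Dlin.xi := by
  refine ⟨saftRel_coring, fun C _ _ _ _ Λ f hf =>
    ⟨hf.toDlin, ⟨hf.isCoringHom_toDlin, hf.xi_toDlin⟩, fun g hg => ?_⟩⟩
  exact BimodHom.ext_apply fun c => xi_injective ((hg.2 c).trans (hf.xi_toDlin c).symm)

end DlinSaft

/-! ### Transport of corings and Hopf algebroids -/

section Transport

variable {K : Type u} [Field K]

theorem BiTensor.leftUnitor_map {M N N' : Type*} [AddCommGroup M] [Module K M] [Module Kᵐᵒᵖ M]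
    [AddCommGroup N] [Module K N] [Module Kᵐᵒᵖ N] [AddCommGroup N'] [Module K N'] [Module Kᵐᵒᵖ N']
    (f : BimodHom K M K) (g : BimodHom K N N')
    (z : BiTensor K M N) : BiTensor.leftUnitor N' (BiTensor.map f g z) =
      g (BiTensor.leftUnitor N (BiTensor.map f (BimodHom.id K N) z)) := by
  obtain ⟨r, a, b, rfl⟩ := BiTensor.exists_eq_sum z
  rw [map_sum_tmul, map_sum_tmul, map_sum, map_sum, BimodHom.apply_sum]
  exact Finset.sum_congr rfl fun i _ => (g.apply_smul _ _).symm

theorem BiTensor.rightUnitor_map {M N M' : Type*} [AddCommGroup M] [Module K M] [Module Kᵐᵒᵖ M]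
    [AddCommGroup N] [Module K N] [Module Kᵐᵒᵖ N] [AddCommGroup M'] [Module K M'] [Module Kᵐᵒᵖ M']
    (f : BimodHom K M M') (g : BimodHom K N K)
    (z : BiTensor K M N) : BiTensor.rightUnitor M' (BiTensor.map f g z) =
      f (BiTensor.rightUnitor M (BiTensor.map (BimodHom.id K M) g z)) := by
  obtain ⟨r, a, b, rfl⟩ := BiTensor.exists_eq_sum z
  rw [map_sum_tmul, map_sum_tmul, map_sum, map_sum, BimodHom.apply_sum]
  exact Finset.sum_congr rfl fun i _ => (f.apply_rsmul _ _).symm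

section
variable {M N P M' N' P' : Type*}
  [AddCommGroup M] [Module K M] [Module Kᵐᵒᵖ M] [SMulCommClass K Kᵐᵒᵖ M]
  [AddCommGroup N] [Module K N] [Module Kᵐᵒᵖ N] [SMulCommClass K Kᵐᵒᵖ N]
  [AddCommGroup P] [Module K P] [Module Kᵐᵒᵖ P] [SMulCommClass K Kᵐᵒᵖ P]
  [AddCommGroup M'] [Module K M'] [Module Kᵐᵒᵖ M'] [SMulCommClass K Kᵐᵒᵖ M']
  [AddCommGroup N'] [Module K N'] [Module Kᵐᵒᵖ N'] [SMulCommClass K Kᵐᵒᵖ N']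
  [AddCommGroup P'] [Module K P'] [Module Kᵐᵒᵖ P'] [SMulCommClass K Kᵐᵒᵖ P']

/-- The map `f ⊗ g` as a homomorphism of bimodules. -/
def BiTensor.mapHom (f : BimodHom K M M') (g : BimodHom K N N') :
    BimodHom K (BiTensor K M N) (BiTensor K M' N') where
  toFun := BiTensor.map f g
  map_add' := map_add _
  map_smul' x z := by
    induction z using BiTensor.induction_on with
    | zero => simp only [smul_zero, map_zero]
    | tmul m n => exact congrArg (BiTensor.tmul K · (g n)) (f.apply_smul x m)
    | add a b ha hb => simp only [smul_add, map_add, ha, hb]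
  map_rsmul x z := by
    induction z using BiTensor.induction_on with
    | zero => simp only [smul_zero, map_zero]
    | tmul m n => exact congrArg (BiTensor.tmul K (f m)) (g.apply_rsmul x n)
    | add a b ha hb => simp only [smul_add, map_add, ha, hb]

theorem BiTensor.assoc_map (f : BimodHom K M M') (g : BimodHom K N N') (h : BimodHom K P P')
    (z : BiTensor K (BiTensor K M N) P) :
    BiTensor.assoc M' N' P' (BiTensor.map (BiTensor.mapHom f g) h z) =
      BiTensor.map f (BiTensor.mapHom g h) (BiTensor.assoc M N P z) := by
  induction z using BiTensor.induction_on with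
  | zero => simp only [map_zero]
  | tmul w p =>
    induction w using BiTensor.induction_on with
    | zero =>
      rw [show BiTensor.tmul K (0 : BiTensor K M N) p = 0 from
        map_zero ((BiTensor.tmulHom K (BiTensor K M N) P).flip p)]
      simp only [map_zero]
    | tmul m n => rfl
    | add a b ha hb => simp only [BiTensor.add_tmul, map_add, ha, hb]
  | add a b ha hb => simp only [map_add, ha, hb]

end

variable [Differential K]
  {C : Type v} [AddCommGroup C] [Module K C] [Module Kᵐᵒᵖ C] [SMulCommClass K Kᵐᵒᵖ C]
  {D : Type w} [AddCommGroup D] [Module K D] [Module Kᵐᵒᵖ D] [SMulCommClass K Kᵐᵒᵖ D]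

theorem IsCoringHom.id (Γ : Coring K C) : IsCoringHom Γ Γ (BimodHom.id K C) where
  comul _ := (BiTensor.map_id _).symm
  counit _ := rfl

theorem IsCoringHom.comp {E : Type*} [AddCommGroup E] [Module K E] [Module Kᵐᵒᵖ E]
    [SMulCommClass K Kᵐᵒᵖ E] {Γ : Coring K C} {Λ : Coring K D} {Ξ : Coring K E}
    {g : BimodHom K D E} {f : BimodHom K C D} (hg : IsCoringHom Λ Ξ g) (hf : IsCoringHom Γ Λ f) :
    IsCoringHom Γ Ξ (g.comp f) where
  comul c := by rw [BimodHom.comp_apply, hg.comul, hf.comul, BiTensor.map_map]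
  counit c := by rw [BimodHom.comp_apply, hg.counit, hf.counit]

theorem IsCoringHom.inverse {Γ : Coring K C} {Λ : Coring K D} {e : BimodHom K C D}
    {g : BimodHom K D C} (he : IsCoringHom Γ Λ e) (hge : ∀ c, g (e c) = c)
    (heg : ∀ d, e (g d) = d) : IsCoringHom Λ Γ g where
  comul d := by
    have h : g.comp e = BimodHom.id K C := BimodHom.ext_apply hge
    conv_rhs => rw [← heg d, he.comul, BiTensor.map_map, h, BiTensor.map_id]
  counit d := by
    conv_rhs => rw [← heg d, he.counit]

/-- The coring structure on `D` for which the isomorphism of bimodules `e : C → D`, with inverse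
`g`, is an isomorphism of corings. -/
def Coring.transport (Γ : Coring K C) (e : BimodHom K C D) (g : BimodHom K D C)
    (hge : ∀ c, g (e c) = c) (heg : ∀ d, e (g d) = d) : Coring K D where
  central x hx d := by
    rw [← heg d, ← BimodHom.apply_smul, ← BimodHom.apply_rsmul, Γ.central x hx]
  comul := (BiTensor.mapHom e e).comp (Γ.comul.comp g)
  counit := Γ.counit.comp g
  coassoc d := by
    have h1 : ((BiTensor.mapHom e e).comp (Γ.comul.comp g)).comp e =
        (BiTensor.mapHom e e).comp Γ.comul := BimodHom.ext_apply fun c =>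
      congrArg (fun c => BiTensor.mapHom e e (Γ.comul c)) (hge c)
    change BiTensor.assoc D D D (BiTensor.map _ _ (BiTensor.map e e (Γ.comul (g d)))) =
      BiTensor.map _ _ (BiTensor.map e e (Γ.comul (g d)))
    rw [BiTensor.map_map, BiTensor.map_map, h1]
    have h2 := congrArg (BiTensor.map e (BiTensor.mapHom e e)) (Γ.coassoc (g d))
    rw [← BiTensor.assoc_map, BiTensor.map_map, BiTensor.map_map] at h2
    exact h2
  counit_left d := by
    have h1 : (Γ.counit.comp g).comp e = Γ.counit := BimodHom.ext_apply fun c =>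
      congrArg Γ.counit (hge c)
    change BiTensor.leftUnitor D (BiTensor.map _ _ (BiTensor.map e e (Γ.comul (g d)))) = d
    rw [BiTensor.map_map, h1, BiTensor.leftUnitor_map, Γ.counit_left]
    exact heg d
  counit_right d := by
    have h1 : (Γ.counit.comp g).comp e = Γ.counit := BimodHom.ext_apply fun c =>
      congrArg Γ.counit (hge c)
    change BiTensor.rightUnitor D (BiTensor.map _ _ (BiTensor.map e e (Γ.comul (g d)))) = d
    rw [BiTensor.map_map, h1, BiTensor.rightUnitor_map, Γ.counit_right]
    exact heg d

theorem Coring.isCoringHom_transport (Γ : Coring K C) (e : BimodHom K C D) (g : BimodHom K D C)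
    (hge : ∀ c, g (e c) = c) (heg : ∀ d, e (g d) = d) :
    IsCoringHom Γ (Γ.transport e g hge heg) e where
  comul c := congrArg (fun c => BiTensor.map e e (Γ.comul c)) (hge c)
  counit c := congrArg Γ.counit (hge c)

theorem IsHopfIso.inverse {H : HopfAlgebroid K C} {L : HopfAlgebroid K D}
    {e : BimodHom K C D} {g : BimodHom K D C} (he : IsHopfIso H L e) (hge : ∀ c, g (e c) = c)
    (heg : ∀ d, e (g d) = d) : IsHopfIso L H g where
  toIsCoringHom := he.toIsCoringHom.inverse hge heg
  one := by rw [← he.one, hge]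
  mul a b := by
    conv_lhs => rw [← heg a, ← heg b, ← he.mul, hge]
  antipode a := by
    conv_lhs => rw [← heg a, ← he.antipode, hge]
  bijective := ⟨Function.LeftInverse.injective heg, Function.RightInverse.surjective hge⟩

namespace HopfAlgebroid

/-- The Hopf algebroid structure on a coring `Λ` carried over from a Hopf algebroid along an
isomorphism `e` of corings with inverse `g`. -/
def transport (H : HopfAlgebroid K C) (Λ : Coring K D) (e : BimodHom K C D) (g : BimodHom K D C)
    (hge : ∀ c, g (e c) = c) (heg : ∀ d, e (g d) = d) (he : IsCoringHom H.toCoring Λ e) :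
    HopfAlgebroid K D where
  toCoring := Λ
  mul a b := e (H.mul (g a) (g b))
  one := e H.one
  antipode a := e (H.antipode (g a))
  add_mul a b c := by rw [g.apply_add, H.add_mul, e.apply_add]
  mul_comm a b := by rw [H.mul_comm]
  mul_assoc a b c := by rw [hge, hge, H.mul_assoc]
  one_mul a := by rw [hge, H.one_mul, heg]
  smul_mul x a b := by rw [g.apply_smul, H.smul_mul, e.apply_smul]
  rsmul_mul x a b := by rw [g.apply_rsmul, H.rsmul_mul, e.apply_rsmul]
  counit_one := by rw [he.counit, H.counit_one]
  counit_mul a b := by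
    rw [he.counit, H.counit_mul, ← he.counit, ← he.counit, heg, heg]
  comul_one := by rw [he.comul, H.comul_one, BiTensor.map_tmul]
  comul_mul a b m n a₁ a₂ b₁ b₂ ha hb := by
    have hg := he.inverse hge heg
    rw [he.comul, H.comul_mul (g a) (g b) m n (fun i => g (a₁ i)) (fun i => g (a₂ i))
      (fun j => g (b₁ j)) (fun j => g (b₂ j))
      (by rw [hg.comul, ha, BiTensor.map_sum_tmul]) (by rw [hg.comul, hb, BiTensor.map_sum_tmul]),
      map_sum]
    exact Finset.sum_congr rfl fun i _ => BiTensor.map_sum_tmul _ _ _ _ _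
  antipode_add a b := by rw [g.apply_add, H.antipode_add, e.apply_add]
  antipode_mul a b := by rw [hge, hge, hge, H.antipode_mul]
  antipode_source x := by
    rw [g.apply_smul, hge, H.antipode_source, e.apply_rsmul]
  antipode_target x := by
    rw [g.apply_rsmul, hge, H.antipode_target, e.apply_smul]
  antipode_antipode a := by rw [hge, H.antipode_antipode, heg]
  antipode_left a m a₁ a₂ h := by
    have hg := he.inverse hge heg
    rw [← hg.counit, ← e.apply_rsmul, ← H.antipode_left (g a) m (fun i => g (a₁ i))
      (fun i => g (a₂ i)) (by rw [hg.comul, h, BiTensor.map_sum_tmul]), e.apply_sum]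
    exact Finset.sum_congr rfl fun i _ => by rw [hge]
  antipode_right a m a₁ a₂ h := by
    have hg := he.inverse hge heg
    rw [← hg.counit, ← e.apply_smul, ← H.antipode_right (g a) m (fun i => g (a₁ i))
      (fun i => g (a₂ i)) (by rw [hg.comul, h, BiTensor.map_sum_tmul]), e.apply_sum]
    exact Finset.sum_congr rfl fun i _ => by rw [hge]

theorem isHopfIso_transport (H : HopfAlgebroid K C) (Λ : Coring K D) (e : BimodHom K C D)
    (g : BimodHom K D C) (hge : ∀ c, g (e c) = c) (heg : ∀ d, e (g d) = d)
    (he : IsCoringHom H.toCoring Λ e) : IsHopfIso H (H.transport Λ e g hge heg he) e where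
  toIsCoringHom := he
  one := rfl
  mul a b := (congrArg₂ (fun a b => e (H.mul a b)) (hge a) (hge b)).symm
  antipode a := (congrArg (fun a => e (H.antipode a)) (hge a)).symm
  bijective := ⟨Function.LeftInverse.injective hge, Function.RightInverse.surjective heg⟩

/-! ### Uniqueness of the antipode -/

theorem mul_add (H : HopfAlgebroid K C) (a b c : C) :
    H.mul a (b + c) = H.mul a b + H.mul a c := by
  rw [H.mul_comm, H.add_mul, H.mul_comm b, H.mul_comm c]

theorem mul_smul (H : HopfAlgebroid K C) (x : K) (a b : C) :
    H.mul a (x • b) = x • H.mul a b := by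
  rw [H.mul_comm, H.smul_mul, H.mul_comm]

theorem mul_rsmul (H : HopfAlgebroid K C) (x : K) (a b : C) :
    H.mul a (b <• x) = H.mul a b <• x := by
  rw [H.mul_comm, H.rsmul_mul, H.mul_comm]

theorem mul_one (H : HopfAlgebroid K C) (a : C) : H.mul a H.one = a := by
  rw [H.mul_comm, H.one_mul]

theorem antipode_rsmul (H : HopfAlgebroid K C) (x : K) (a : C) :
    H.antipode (a <• x) = x • H.antipode a := by
  rw [← H.one_mul a, ← H.rsmul_mul, H.antipode_mul, H.antipode_target, H.smul_mul, H.one_mul,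
    H.one_mul]

theorem antipode_smul (H : HopfAlgebroid K C) (x : K) (a : C) :
    H.antipode (x • a) = H.antipode a <• x := by
  rw [← H.one_mul a, ← H.smul_mul, H.antipode_mul, H.antipode_source, H.rsmul_mul, H.one_mul,
    H.one_mul]

/-- The multiplication as a biadditive map. -/
def mulHom (H : HopfAlgebroid K C) : C →+ C →+ C :=
  AddMonoidHom.mk' (fun a => AddMonoidHom.mk' (H.mul a) (H.mul_add a))
    (fun a b => by ext c; exact H.add_mul a b c)

/-- The antipode as an additive map. -/
def antipodeHom (H : HopfAlgebroid K C) : C →+ C := AddMonoidHom.mk' H.antipode H.antipode_add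

theorem antipode_sum (H : HopfAlgebroid K C) {ι : Type*} (s : Finset ι) (a : ι → C) :
    H.antipode (∑ i ∈ s, a i) = ∑ i ∈ s, H.antipode (a i) := map_sum H.antipodeHom a s

theorem sum_mul (H : HopfAlgebroid K C) {ι : Type*} (s : Finset ι) (a : ι → C) (b : C) :
    H.mul (∑ i ∈ s, a i) b = ∑ i ∈ s, H.mul (a i) b := map_sum (H.mulHom.flip b) a s

theorem mul_sum (H : HopfAlgebroid K C) {ι : Type*} (s : Finset ι) (a : C) (b : ι → C) :
    H.mul a (∑ i ∈ s, b i) = ∑ i ∈ s, H.mul a (b i) := map_sum (H.mulHom a) b s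

/-- The antipode of a commutative Hopf algebroid is determined by its coring and ring structures:
for two antipodes `S` and `S'`, compute `∑ S(a₁) a₂ S'(a₃)` in two ways. -/
theorem antipode_unique (H L : HopfAlgebroid K C) (hc : L.toCoring = H.toCoring)
    (hm : ∀ a b, L.mul a b = H.mul a b) (ho : L.one = H.one) (a : C) :
    H.antipode a = L.antipode a := by
  have hm' : L.mul = H.mul := funext fun a => funext (hm a)
  let F : C → BiTensor K C C →+ C := fun a =>
    BiTensor.lift ((H.mulHom.comp (H.mulHom (H.antipode a))).compl₂ L.antipodeHom)
      (fun b x c => by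
        change H.mul (H.mul (H.antipode a) (b <• x)) (L.antipode c) =
          H.mul (H.mul (H.antipode a) b) (L.antipode (x • c))
        rw [L.antipode_smul, H.mul_rsmul, H.rsmul_mul, H.mul_rsmul])
  have hF : ∀ a b c, F a (BiTensor.tmul K b c) =
    H.mul (H.mul (H.antipode a) b) (L.antipode c) := fun _ _ _ => rfl
  let G : BiTensor K C (BiTensor K C C) →+ C := BiTensor.lift
    (AddMonoidHom.mk' F fun a a' => BiTensor.hom_ext fun b c => by
      rw [AddMonoidHom.add_apply, hF, hF, hF, H.antipode_add, H.add_mul, H.add_mul])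
    (fun a x z => by
      change F (a <• x) z = F a (x • z)
      induction z using BiTensor.induction_on with
      | zero => simp only [smul_zero, map_zero]
      | tmul b c => rw [BiTensor.smul_tmul, hF, hF, H.antipode_rsmul, H.smul_mul, H.mul_smul]
      | add z w hz hw => simp only [smul_add, map_add, hz, hw])
  have hG : ∀ a z, G (BiTensor.tmul K a z) = F a z := fun _ _ => rfl
  have hG1 : ∀ z c, G (BiTensor.assoc C C C (BiTensor.tmul K (H.comul z) c)) =
      L.antipode (H.counit z • c) := fun z c => by
    obtain ⟨r, p, q, h⟩ := BiTensor.exists_eq_sum (H.comul z)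
    rw [h, BiTensor.sum_tmul, map_sum, map_sum]
    simp only [BiTensor.assoc_tmul, hG, hF]
    rw [← H.sum_mul, H.antipode_left z r p q h, H.rsmul_mul, H.one_mul, L.antipode_smul]
  have hG2 : ∀ z c, G (BiTensor.tmul K z (H.comul c)) = H.antipode (z <• H.counit c) :=
      fun z c => by
    obtain ⟨r, p, q, h⟩ := BiTensor.exists_eq_sum (H.comul c)
    have h' := L.antipode_right c r p q (by rw [hc, h])
    rw [hm', ho, hc] at h'
    rw [h, BiTensor.tmul_sum, map_sum]
    simp only [hG, hF, H.mul_assoc]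
    rw [← H.mul_sum, h', H.mul_smul, H.mul_one, H.antipode_rsmul]
  obtain ⟨r, p, q, h⟩ := BiTensor.exists_eq_sum (H.comul a)
  have key := congrArg G (H.coassoc a)
  have hl := H.counit_left a
  have hr := H.counit_right a
  rw [h, BiTensor.map_sum_tmul, BiTensor.map_sum_tmul, map_sum, map_sum, map_sum] at key
  rw [h, BiTensor.map_sum_tmul, map_sum] at hl hr
  simp only [BimodHom.id_apply, hG1, hG2] at key
  rw [← L.antipode_sum, ← H.antipode_sum] at key
  have hl' : ∑ i, H.counit (p i) • q i = a := hl
  have hr' : ∑ i, p i <• H.counit (q i) = a := hr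
  rw [hl', hr'] at key
  exact key.symm

theorem eq_of_toCoring_eq {H L : HopfAlgebroid K C} (hc : L.toCoring = H.toCoring)
    (hm : ∀ a b, L.mul a b = H.mul a b) (ho : L.one = H.one) : L = H := by
  have hS : H.antipode = L.antipode := funext (antipode_unique H L hc hm ho)
  have hm' : L.mul = H.mul := funext fun a => funext (hm a)
  cases H
  cases L
  dsimp only at hc hm' ho hS
  subst hc hm' ho hS
  rfl

end HopfAlgebroid

/-! ### Corings with the universal property -/

/-- A SAFT-dual coring is isomorphic to `Dlin K`, compatibly with the maps to `U*`. -/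
theorem IsSaftDual.exists_coringIso {V : Type u} [AddCommGroup V] [Module K V] [Module Kᵐᵒᵖ V]
    [SMulCommClass K Kᵐᵒᵖ V] {Γ : Coring K V} {ξ : V →+ Ore.Dual K}
    (h : IsSaftDual.{u, u, u} Γ ξ) :
    ∃ (e : BimodHom K (Dlin K) V) (g : BimodHom K V (Dlin K)),
      (∀ α, g (e α) = α) ∧ (∀ z, e (g z) = z) ∧ IsCoringHom (Dlin.coring K) Γ e ∧
      ∀ α, ξ (e α) = Dlin.xi α := by
  obtain ⟨e, ⟨he, hξ⟩, -⟩ := h.2 (Dlin K) (Dlin.coring K) Dlin.xi Dlin.saftRel_coring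
  have hg := h.1.xi_toDlin
  refine ⟨e, h.1.toDlin, fun α => Dlin.xi_injective ((hg _).trans (hξ α)), fun z => ?_, he, hξ⟩
  have huniq := (h.2 V Γ ξ h.1).unique
    (y₁ := e.comp h.1.toDlin) (y₂ := BimodHom.id K V)
    ⟨he.comp h.1.isCoringHom_toDlin, fun c => (hξ _).trans (hg c)⟩
    ⟨IsCoringHom.id Γ, fun _ => rfl⟩
  exact congrArg (fun f : BimodHom K V V => f z) huniq

/-- A SAFT-dual coring has exactly one Hopf algebroid structure with multiplication induced by the
convolution of `U*`, and with it there is exactly one compatible isomorphism from `Dlin K`. -/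
theorem IsSaftDual.existsUnique_hopf {V : Type u} [AddCommGroup V] [Module K V] [Module Kᵐᵒᵖ V]
    [SMulCommClass K Kᵐᵒᵖ V] {Γ : Coring K V} {ξ : V →+ Ore.Dual K}
    (h : IsSaftDual.{u, u, u} Γ ξ) :
    (∃! HV : HopfAlgebroid K V, HV.toCoring = Γ ∧ RespectsConv HV ξ) ∧
      ∀ HV : HopfAlgebroid K V, HV.toCoring = Γ → RespectsConv HV ξ →
        ∃! e : BimodHom K (Dlin K) V, IsHopfIso (Dlin.hopf K) HV e ∧ ∀ α, ξ (e α) = Dlin.xi α := by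
  obtain ⟨e, g, hge, heg, he, hξ⟩ := h.exists_coringIso
  have hξg : ∀ z, Dlin.xi (g z) = ξ z := fun z => by rw [← hξ, heg]
  have hinj : Function.Injective ξ := fun z w hzw => by
    rw [← heg z, ← heg w, Dlin.xi_injective ((hξg z).trans (hzw.trans (hξg w).symm))]
  let H := (Dlin.hopf K).transport Γ e g hge heg he
  have hH : RespectsConv H ξ :=
    { one := (hξ _).trans Dlin.respectsConv_hopf.one
      mul := fun a b => by
        rw [← hξg a, ← hξg b, ← Dlin.respectsConv_hopf.mul, ← hξ]
        rfl }
  have huniq : ∀ HV : HopfAlgebroid K V, HV.toCoring = Γ → RespectsConv HV ξ → HV = H :=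
    fun HV hΓ hV => HopfAlgebroid.eq_of_toCoring_eq hΓ
      (fun a b => hinj ((hV.mul a b).trans (hH.mul a b).symm)) (hinj (hV.one.trans hH.one.symm))
  refine ⟨⟨H, ⟨rfl, hH⟩, fun HV hV => huniq HV hV.1 hV.2⟩, fun HV hΓ hV => ?_⟩
  obtain rfl := huniq HV hΓ hV
  exact ⟨e, ⟨HopfAlgebroid.isHopfIso_transport _ _ _ _ _ _ _, hξ⟩, fun e' he' =>
    BimodHom.ext_apply fun α => hinj ((he'.2 α).trans (hξ α).symm)⟩

end Transport

/-! ### The finite dual -/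

section FiniteDual

open Hurwitz

variable {K : Type u} [Field K] [Differential K]

namespace DiffMod

/-- The direct sum of two differential vector spaces. -/
def prod (M N : DiffMod K) : DiffMod K where
  carrier := M × N
  der := AddMonoidHom.prodMap M.der N.der
  leibniz x m := Prod.ext (M.leibniz x m.1) (N.leibniz x m.2)

/-- The inclusion of the first summand. -/
def inl (M N : DiffMod K) : Hom M (M.prod N) where
  toLin := LinearMap.inl K M N
  comm _ := Prod.ext rfl (map_zero N.der).symm

/-- The inclusion of the second summand. -/
def inr (M N : DiffMod K) : Hom N (M.prod N) where
  toLin := LinearMap.inr K M N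
  comm _ := Prod.ext (map_zero M.der).symm rfl

/-- The subspace spanned by the iterated derivatives of `m`. -/
def cyclicSpan (M : DiffMod K) (m : M) : Submodule K M :=
  Submodule.span K (Set.range fun n => M.der^[n] m)

theorem der_mem_cyclicSpan (M : DiffMod K) (m : M) {x : M} (hx : x ∈ M.cyclicSpan m) :
    M.der x ∈ M.cyclicSpan m := by
  induction hx using Submodule.span_induction with
  | mem x hx =>
    obtain ⟨n, rfl⟩ := hx
    exact Submodule.subset_span ⟨n + 1, Function.iterate_succ_apply' _ _ _⟩
  | zero => rw [map_zero]; exact Submodule.zero_mem _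
  | add x y _ _ hx hy => rw [map_add]; exact Submodule.add_mem _ hx hy
  | smul a x hx ih =>
    rw [leibniz]
    exact Submodule.add_mem _ (Submodule.smul_mem _ _ ih) (Submodule.smul_mem _ _ hx)

/-- The differential subspace generated by `m`. -/
def cyclic (M : DiffMod K) (m : M) : DiffMod K where
  carrier := M.cyclicSpan m
  der := AddMonoidHom.mk' (fun x => ⟨M.der x, M.der_mem_cyclicSpan m x.2⟩)
    (fun x y => Subtype.ext (map_add M.der (x : M) y))
  leibniz x y := Subtype.ext (M.leibniz x (y : M))

/-- The inclusion of the differential subspace generated by `m`. -/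
def cyclicIncl (M : DiffMod K) (m : M) : Hom (M.cyclic m) M where
  toLin := (M.cyclicSpan m).subtype
  comm _ := rfl

end DiffMod

namespace Circ

/-- Sums in `U°` are absorbed by direct sums of differential vector spaces. -/
theorem exists_eq_mk (z : Circ K) :
    ∃ (M : DiffMod K) (φ : Module.Dual K M) (m : M), z = mk M φ m := by
  induction z using induction_on with
  | zero => exact ⟨DiffMod.unit K, 0, 0, (mk_zero_left _ _).symm⟩
  | mk M φ m => exact ⟨M, φ, m, rfl⟩
  | add a b ha hb =>
    obtain ⟨M, φ, m, rfl⟩ := ha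
    obtain ⟨N, ψ, n, rfl⟩ := hb
    let χ : Module.Dual K (M.prod N) := LinearMap.coprod φ ψ
    have h1 : mk (M.prod N) χ ((DiffMod.inl M N).toLin m) = mk M φ m :=
      (mk_hom (DiffMod.inl M N) χ m).trans
        (congrArg (mk M · m) (LinearMap.coprod_inl φ ψ))
    have h2 : mk (M.prod N) χ ((DiffMod.inr M N).toLin n) = mk N ψ n :=
      (mk_hom (DiffMod.inr M N) χ n).trans
        (congrArg (mk N · n) (LinearMap.coprod_inr φ ψ))
    exact ⟨M.prod N, χ, _, by rw [← h1, ← h2, ← mk_add_right]⟩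

/-- A functional which vanishes on all derivatives of `m` vanishes on the differential subspace
generated by `m`. -/
theorem mk_eq_zero (M : DiffMod K) (φ : Module.Dual K M) (m : M)
    (h : ∀ n : ℕ, φ (M.der^[n] m) = 0) : mk M φ m = 0 := by
  have hm : m ∈ M.cyclicSpan m := Submodule.subset_span ⟨0, rfl⟩
  have h0 : φ ∘ₗ (M.cyclicIncl m).toLin = 0 := by
    have hle : M.cyclicSpan m ≤ LinearMap.ker φ :=
      Submodule.span_le.mpr (by rintro _ ⟨n, rfl⟩; exact h n)
    exact LinearMap.ext fun x => hle x.2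
  exact (mk_hom (M.cyclicIncl m) φ ⟨m, hm⟩).trans
    ((congrArg (mk (M.cyclic m) · ⟨m, hm⟩) h0).trans (mk_zero_left _ _))

/-- The map `φ ⊗ m ↦ (φ (∂ⁿ m))ₙ` as an additive map. -/
def toDlinAddHom : Circ K →+ Dlin K :=
  lift (fun M => AddMonoidHom.mk'
      (fun φ => AddMonoidHom.mk' (fun m => Dlin.matrixCoeff M φ m)
        (fun m n => Subtype.ext (M.coeffSeq_add_right φ m n)))
      (fun φ ψ => by ext m : 1; exact Subtype.ext (M.coeffSeq_add_left φ ψ m)))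
    (fun _ _ f ψ m => Subtype.ext (DiffMod.coeffSeq_hom f ψ m))

theorem toDlinAddHom_mk (M : DiffMod K) (φ : Module.Dual K M) (m : M) :
    toDlinAddHom (mk M φ m) = Dlin.matrixCoeff M φ m := lift_mk _ _ _ _ _

variable (K) in
/-- The map `φ ⊗ m ↦ (φ (∂ⁿ m))ₙ` from `U°` to `Dlin K`. -/
def toDlin : BimodHom K (Circ K) (Dlin K) where
  toFun := toDlinAddHom
  map_add' := map_add _
  map_smul' x z := by
    obtain ⟨M, φ, m, rfl⟩ := exists_eq_mk z
    rw [smul_mk, toDlinAddHom_mk, toDlinAddHom_mk]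
    rfl
  map_rsmul x z := by
    obtain ⟨M, φ, m, rfl⟩ := exists_eq_mk z
    rw [mk_rsmul, toDlinAddHom_mk, toDlinAddHom_mk]
    exact Subtype.ext (M.coeffSeq_smul_right x φ m)

theorem toDlin_mk (M : DiffMod K) (φ : Module.Dual K M) (m : M) :
    toDlin K (mk M φ m) = Dlin.matrixCoeff M φ m := toDlinAddHom_mk M φ m

theorem toDlin_bijective : Function.Bijective (toDlin K).toFun := by
  constructor
  · refine (injective_iff_map_eq_zero (toDlinAddHom (K := K))).mpr fun z hz => ?_
    obtain ⟨M, φ, m, rfl⟩ := exists_eq_mk z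
    rw [toDlinAddHom_mk] at hz
    exact mk_eq_zero M φ m fun n => congrArg (fun α : Dlin K => (α : Hurwitz K).coeff n) hz
  · intro α
    obtain ⟨M, φ, m, rfl⟩ := Dlin.exists_matrixCoeff α
    exact ⟨_, toDlin_mk M φ m⟩

/-- The finite dual is a Hopf algebroid isomorphic to `Dlin K` through matrix coefficients. -/
theorem exists_hopf : ∃ H : HopfAlgebroid K (Circ K), IsCircHopf H ∧
    IsHopfIso H (Dlin.hopf K) (toDlin K) := by
  obtain ⟨e, heθ, hθe⟩ := (toDlin K).exists_inverse toDlin_bijective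
  have he : ∀ M φ m, e (Dlin.matrixCoeff M φ m) = mk M φ m := fun M φ m => by
    rw [← toDlin_mk, heθ]
  have heq : ∀ (α : Dlin K) M φ m, (α : Hurwitz K) = DiffMod.coeffSeq M φ m → e α = mk M φ m :=
    fun α M φ m h => (congrArg e (Subtype.ext h)).trans (he M φ m)
  let Λ := (Dlin.coring K).transport e (toDlin K) hθe heθ
  have hΛ : IsCoringHom (Dlin.hopf K).toCoring Λ e :=
    (Dlin.coring K).isCoringHom_transport e (toDlin K) hθe heθ
  let H := (Dlin.hopf K).transport Λ e (toDlin K) hθe heθ hΛ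
  have hH : IsHopfIso (Dlin.hopf K) H e :=
    (Dlin.hopf K).isHopfIso_transport Λ e (toDlin K) hθe heθ hΛ
  refine ⟨H, ?_, hH.inverse hθe heθ⟩
  refine
    { source := fun x => ?_
      target := fun x => ?_
      mul := fun P Q φ p ψ q => ?_
      counit := fun M φ m => ?_
      comul := fun M φ m n b => ?_
      antipode := fun M φ m => ?_ }
  · rw [← hH.one, ← e.apply_smul]
    refine heq _ _ _ _ ((Dlin.coe_smul_one x).trans ?_)
    ext n
    cases n with
    | zero => exact (one_mul x).symm
    | succ n =>
      have h1 : (1 : Hurwitz K).coeff (n + 1) = (Differential.deriv (R := K))^[n + 1] 1 := by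
        rw [← target_coeff, map_one]
      change (1 : Hurwitz K).coeff (n + 1) = _ at h1
      change (0 : K) = (Differential.deriv (R := K))^[n + 1] 1 * x
      rw [← h1]
      exact (zero_mul x).symm
  · rw [← hH.one, ← e.apply_rsmul]
    exact heq _ _ _ _ (Dlin.coe_one_rsmul x)
  · rw [← he P, ← he Q, ← hH.mul]
    exact heq _ _ _ _ (DiffMod.coeffSeq_mul φ p ψ q)
  · rw [← he M, hH.counit]
    rfl
  · rw [← he M, hH.comul, Dlin.hopf_comul_matrixCoeff M φ m b, BiTensor.map_sum_tmul]
    exact Finset.sum_congr rfl fun i _ => by rw [he, he]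
  · rw [← he M, ← hH.antipode]
    exact heq _ _ _ _ (M.antipode_coeffSeq φ m)

end Circ

end FiniteDual

end DRec

end

/-- The differentially recursive sequences over a differential field `K` carry a Hopf algebroid
structure which, with the inclusion in `U*`, is the dual coring `U^•`; and there are isomorphisms
`U° ≅ Dlin K ≅ U^•` of Hopf algebroids. -/
theorem theorem2 (K : Type u) [Field K] [Differential K] :
    ∃ HD : DRec.HopfAlgebroid K (DRec.Dlin K),
      DRec.IsDlinHopf HD ∧
      DRec.RespectsConv HD DRec.Dlin.xi ∧
      Function.Injective (DRec.Dlin.xi (K := K)) ∧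
      DRec.IsSaftDual.{u, v, u} HD.toCoring DRec.Dlin.xi ∧
      (∃ HC : DRec.HopfAlgebroid K (DRec.Circ K),
        DRec.IsCircHopf HC ∧
        ∃ θ : DRec.BimodHom K (DRec.Circ K) (DRec.Dlin K),
          DRec.IsHopfIso HC HD θ ∧
          ∀ (M : DRec.DiffMod K) (φ : Module.Dual K M) (m : M) (n : ℕ),
            (θ (DRec.Circ.mk M φ m) : DRec.Hurwitz K).coeff n = φ (M.der^[n] m)) ∧
      (∀ (V : Type u) [AddCommGroup V] [Module K V] [Module Kᵐᵒᵖ V] [SMulCommClass K Kᵐᵒᵖ V]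
        (Γ : DRec.Coring K V) (ξ : V →+ DRec.Ore.Dual K),
        DRec.IsSaftDual.{u, u, u} Γ ξ →
          (∃! HV : DRec.HopfAlgebroid K V, HV.toCoring = Γ ∧ DRec.RespectsConv HV ξ) ∧
          ∀ HV : DRec.HopfAlgebroid K V, HV.toCoring = Γ → DRec.RespectsConv HV ξ →
            ∃! e : DRec.BimodHom K (DRec.Dlin K) V,
              DRec.IsHopfIso HD HV e ∧ ∀ α, ξ (e α) = DRec.Dlin.xi α) := by
  refine ⟨DRec.Dlin.hopf K, DRec.Dlin.isDlinHopf_hopf, DRec.Dlin.respectsConv_hopf,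
    DRec.Dlin.xi_injective, DRec.Dlin.isSaftDual_coring, ?_,
    fun V _ _ _ _ Γ ξ h => h.existsUnique_hopf⟩
  obtain ⟨H, hH, hiso⟩ := DRec.Circ.exists_hopf (K := K)
  refine ⟨H, hH, DRec.Circ.toDlin K, hiso, fun M φ m n => ?_⟩
  rw [DRec.Circ.toDlin_mk]
  rfl
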